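/- **Model.** Let $n\ge 2$ and $0\le t<n$. There are $n$ processes in a synchronous message-passing system. Time is $m=0,1,2,\dots$, and round $m+1$ takes place between times $m$ and $m+1$. An *adversary* $\alpha$ consists of an input vector in $\{0,1\}^n$ and a crash failure pattern with at most $t$ crashes: a process that crashes in round $c+1$ behaves correctly in rounds $1,\dots,c$, delivers its round-$(c+1)$ messages to an arbitrary set of processes, and sends nothing afterwards. It is *active* at the times $m\le c$; a process that never crashes is *correct* and is active at all times. A *protocol* is deterministic: messages and decisions are functions of the local state, and the next local state is a function of the current one and of the messages received. A process decides at most once, at a time at which it is active, on a value in $\{0,1\}$. A protocol $P$ and an adversary $\alpha$ determine a run $P[\alpha]$. A protocol solves a task if all its runs, over all these adversaries, satisfy the specification of the task. * *Consensus*: every correct process decides; if all inputs are $v$ then the correct processes decide $v$; all correct processes decide on the same value. * *Uniform consensus*: the same, with the last condition replaced by: all processes that decide (correct or not) decide on the same value. **Last-decider unbeatability.** $Q$ *last-decider dominates* $P$ if, for every adversary $\alpha$, whenever the last decision in $P[\alpha]$ is at time $m$, all decisions in $Q[\alpha]$ are taken at or before time $m$. The domination is *strict* if moreover $P$ does not last-decider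 dominate $Q$. $P$ is a *last-decider unbeatable* solution to a task if $P$ solves the task and no protocol $Q$ solving the task strictly last-decider dominates $P$. **The protocols.** All three are full-information protocols: in every round every process sends its whole view to all others. The view of $i$ at time $m$ is the subgraph of the communication graph that $i$ has seen: initially the node $(i,0)$ labelled by $i$'s input; at time $m+1$ it is the union of the previous view of $i$ and of all views received in round $m+1$, together with the node $(i,m+1)$ and the edges to it from $(i,m)$ and from $(j,m)$ for every $j$ whose message was received. Process $i$, active at time $m$, *knows* a fact ($K_i$) if the fact holds at time $m$ for every adversary with at most $t$ crashes for which $i$ is active at time $m$ and has the same view at time $m$. Let $\exists 0$ be the fact "some input is $0$"; $\mathsf{notknown}(\exists 0)$ the fact "no process active at the current time knows $\exists 0$"; $\exists\mathsf{correct}(0)$ the fact "some correct process knows $\exists 0$"; $\mathsf{Maj}=0$ the fact "at least $n/2$ inputs are $0$"; $\mathsf{Maj}=1$ the fact "more than $n/2$ inputs are $1$". Let $\mathsf{Maj}\langle i,m\rangle$ be $0$ if at least half of the processes whose input is known to $i$ at time $m$ have input $0$, and $1$ otherwise. A node $(j,k)$ is *revealed* to $(i,m)$ if it lies in the view of $i$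 at time $m$, or if $k\ge 1$ and for some node $(i',k)$ in that view the edge from $(j,k-1)$ to $(i',k)$ is not in the view; time $k$ is revealed to $(i,m)$ if all nodes $(j,k)$ are. An undecided process $i$ at time $m$ acts as follows. * $\mathrm{Opt}_0$: if $K_i\exists 0$, decide $0$; else if $K_i\,\mathsf{notknown}(\exists 0)$, decide $1$. * $\mathrm{Opt}_{\mathsf{Maj}}$: if $K_i(\mathsf{Maj}=0)$, decide $0$; else if $K_i(\mathsf{Maj}=1)$, decide $1$; else if some time $k\le m$ is revealed to $(i,m)$, decide $\mathsf{Maj}\langle i,m\rangle$. * $\mathrm{u\text{-}Opt}_0$: if $K_i\exists\mathsf{correct}(0)$, decide $0$; else if $\neg K_i\exists 0$ and some time $k\le m$ is revealed to $(i,m)$, decide $1$. **Theorem.** For all $n\ge2$ and $0\le t<n$: 1. $\mathrm{Opt}_0$ is a last-decider unbeatable solution to consensus; 2. if $t>0$, then $\mathrm{Opt}_{\mathsf{Maj}}$ is a last-decider unbeatable solution to consensus; 3. $\mathrm{u\text{-}Opt}_0$ is a last-decider unbeatable solution to uniform consensus. The same three statements also hold when, in the definition of last-decider domination, only the decisions of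 correct processes are taken into account (for both $P$ and $Q$). -/

import Mathlib

noncomputable section

open scoped Classical in
/-- `zeroOneRule A B`: decide `0` if `A`, else decide `1` if `B`, else stay undecided. -/
def zeroOneRule (A B : Prop) : Option (Fin 2) :=
  if A then some 0 else if B then some 1 else none

/-! ### Adversaries: binary inputs together with a crash failure pattern -/

/-- An adversary for the processes `Fin n`: an input vector with values in `{0, 1}` and a crash
failure pattern.  Process `i` is active exactly at the times `m ≤ crashTime i`.  If
`crashTime i = c` is finite then `i` crashes in round `c + 1` (the round between times `c` and
`c + 1`), and in that round its messages reach exactly the processes in `lastSent i`;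
`crashTime i = ⊤` means that `i` never crashes. -/
structure Adversary (n : ℕ) where
  input : Fin n → Fin 2
  crashTime : Fin n → ℕ∞
  lastSent : Fin n → Set (Fin n)

namespace Adversary

variable {n : ℕ}

/-- Process `i` has not crashed before time `m`. -/
def Active (α : Adversary n) (i : Fin n) (m : ℕ) : Prop :=
  (m : ℕ∞) ≤ α.crashTime i

/-- Process `i` never crashes. -/
def Correct (α : Adversary n) (i : Fin n) : Prop :=
  α.crashTime i = ⊤

/-- The failure pattern as a layered graph: the edge from the node `(i, m)` to the node
`(j, m + 1)`; a message that `i` sends to `j` in round `m + 1` is delivered. -/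
def Edge (α : Adversary n) (m : ℕ) (i j : Fin n) : Prop :=
  (m : ℕ∞) < α.crashTime i ∨ ((m : ℕ∞) = α.crashTime i ∧ j ∈ α.lastSent i)

/-- At most `t` processes crash: the adversaries of the context with at most `t` crash failures. -/
def InCrash (α : Adversary n) (t : ℕ) : Prop :=
  {i | ¬ α.Correct i}.ncard ≤ t

end Adversary

/-! ### Protocols and their runs -/

/-- A deterministic synchronous message-passing protocol for the processes `Fin n` with binary
inputs.  `init i v` is the state of `i` at time `0` on input `v`; `send s j` is the message that a
process in state `s` sends to `j` in the next round (`none`: no message); `next s r` is the state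
after a round that was started in state `s` and in which `r j` was received from `j`;
`decide s` is the value that a process which is still undecided decides on in state `s`. -/
structure Protocol (n : ℕ) where
  State : Type
  Msg : Type
  init : Fin n → Fin 2 → State
  send : State → Fin n → Option Msg
  next : State → (Fin n → Option Msg) → State
  decide : State → Option (Fin 2)

namespace Protocol

variable {n : ℕ}

open scoped Classical in
/-- The state of process `i` at time `m` in the run of `P` against `α`.  It is meaningful while `i`
is active; a process sends nothing after the round in which it crashes, so later values do not
influence the run. -/
def state (P : Protocol n) (α : Adversary n) : ℕ → Fin n → P.State
  | 0, i => P.init i (α.input i)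
  | m + 1, i => P.next (P.state α m i) fun j =>
      if j ≠ i ∧ α.Edge m j i then P.send (P.state α m j) i else none

open scoped Classical in
/-- The local state of `i` at time `m` in the run of `P` against `α`; `none` is the uninformative
local state of a process that has crashed. -/
def localState (P : Protocol n) (α : Adversary n) (i : Fin n) (m : ℕ) : Option P.State :=
  if α.Active i m then some (P.state α m i) else none

/-- In the run of `P` against `α`, process `i` decides `v` at time `m`.  A process decides at most
once: at the first time (while it is active) at which its state prescribes a decision. -/
def DecidesAt (P : Protocol n) (α : Adversary n) (i : Fin n) (v : Fin 2) (m : ℕ) : Prop :=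
  α.Active i m ∧ P.decide (P.state α m i) = some v ∧
    ∀ k < m, P.decide (P.state α k i) = none

/-- In the run of `P` against `α`, process `i` decides `v` at some time. -/
def Decides (P : Protocol n) (α : Adversary n) (i : Fin n) (v : Fin 2) : Prop :=
  ∃ m, P.DecidesAt α i v m

end Protocol

/-! ### The two decision tasks -/

section Tasks

variable {n : ℕ}

/-- Every correct process decides. -/
def Decision (P : Protocol n) (α : Adversary n) : Prop :=
  ∀ i, α.Correct i → ∃ v, P.Decides α i v

/-- If all inputs are `v` then the correct processes decide `v`. -/
def Validity (P : Protocol n) (α : Adversary n) : Prop :=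
  ∀ v, (∀ j, α.input j = v) → ∀ i, α.Correct i → P.Decides α i v

/-- All correct processes that decide, decide on the same value. -/
def Agreement (P : Protocol n) (α : Adversary n) : Prop :=
  ∀ i j v w, α.Correct i → α.Correct j → P.Decides α i v → P.Decides α j w → v = w

/-- All processes that decide, correct or not, decide on the same value. -/
def UniformAgreement (P : Protocol n) (α : Adversary n) : Prop :=
  ∀ i j v w, P.Decides α i v → P.Decides α j w → v = w

/-- The specification of consensus for a single run. -/
def Consensus (P : Protocol n) (α : Adversary n) : Prop :=
  Decision P α ∧ Validity P α ∧ Agreement P α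

/-- The specification of uniform consensus for a single run. -/
def UniformConsensus (P : Protocol n) (α : Adversary n) : Prop :=
  Decision P α ∧ Validity P α ∧ UniformAgreement P α

/-- `P` solves the task `S` in the context with at most `t` crash failures. -/
def Solves (S : Protocol n → Adversary n → Prop) (t : ℕ) (P : Protocol n) : Prop :=
  ∀ α : Adversary n, α.InCrash t → S P α

end Tasks

/-! ### Last-decider domination

The parameter `who` says which processes are taken into account when decisions are compared:
all of them (`everyone`), or only those that never crash (`Adversary.Correct`). -/

section LastDecider

variable {n : ℕ}

/-- Take the decisions of all processes into account. -/
def everyone (_ : Adversary n) (_ : Fin n) : Prop := True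

/-- `m` is the time of the last decision in the run of `P` against `α`. -/
def IsLastDecisionTime (who : Adversary n → Fin n → Prop) (P : Protocol n) (α : Adversary n)
    (m : ℕ) : Prop :=
  (∃ i v, who α i ∧ P.DecidesAt α i v m) ∧
    ∀ i v m', who α i → P.DecidesAt α i v m' → m' ≤ m

/-- `Q` last-decider dominates `P`: against every adversary, if the last decision of `P` is at
time `m` then all decisions of `Q` are taken before or at time `m`. -/
def LDDominates (who : Adversary n → Fin n → Prop) (t : ℕ) (Q P : Protocol n) : Prop :=
  ∀ α : Adversary n, α.InCrash t → ∀ m, IsLastDecisionTime who P α m →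
    ∀ i v m', who α i → Q.DecidesAt α i v m' → m' ≤ m

/-- `Q` strictly last-decider dominates `P`. -/
def StrictlyLDDominates (who : Adversary n → Fin n → Prop) (t : ℕ) (Q P : Protocol n) : Prop :=
  LDDominates who t Q P ∧ ¬ LDDominates who t P Q

/-- `P` is a last-decider unbeatable solution to the task `S` in the context with at most `t` crash
failures. -/
def LDUnbeatable (who : Adversary n → Fin n → Prop) (S : Protocol n → Adversary n → Prop)
    (t : ℕ) (P : Protocol n) : Prop :=
  Solves S t P ∧ ∀ Q : Protocol n, Solves S t Q → ¬ StrictlyLDDominates who t Q P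

end LastDecider

/-! ### Full-information protocols -/

/-- The view of a process: its name `proc`, the current `time`, and the subgraph of the
communication graph that it has seen, given by its `nodes`, its `edges`, and the `labels`
`(j, v)` of the seen initial nodes (`v` is the input of `j`). -/
structure View (n : ℕ) where
  proc : Fin n
  time : ℕ
  nodes : Set (Fin n × ℕ)
  edges : Set ((Fin n × ℕ) × (Fin n × ℕ))
  labels : Set (Fin n × Fin 2)

section FullInformation

variable {n : ℕ}

/-- The view of process `i` with input `v` at time `0`. -/
def initialView (i : Fin n) (v : Fin 2) : View n where
  proc := i
  time := 0
  nodes := {(i, 0)}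
  edges := ∅
  labels := {(i, v)}

/-- The view after a round that was started with view `s` and in which the views `r j` were
received: the union of `s` and of all received views, the new node, and the edges to it from the
process itself and from all processes that were heard from. -/
def nextView (s : View n) (r : Fin n → Option (View n)) : View n where
  proc := s.proc
  time := s.time + 1
  nodes := {(s.proc, s.time + 1)} ∪ s.nodes ∪ {x | ∃ j w, r j = some w ∧ x ∈ w.nodes}
  edges := s.edges ∪ {e | ∃ j w, r j = some w ∧ e ∈ w.edges} ∪
    {e | ∃ j, (j = s.proc ∨ ∃ w, r j = some w) ∧ e = ((j, s.time), (s.proc, s.time + 1))}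
  labels := s.labels ∪ {x | ∃ j w, r j = some w ∧ x ∈ w.labels}

/-- The full-information protocol with a given decision rule: every process sends its view to all
other processes in every round.  Such protocols differ only in the rule. -/
def fip (rule : View n → Option (Fin 2)) : Protocol n where
  State := View n
  Msg := View n
  init := initialView
  send := fun s _ => some s
  next := nextView
  decide := rule

/-- The view of process `i` at time `m` against `α`, in any full-information protocol (views do not
depend on the decision rule). -/
def view (α : Adversary n) (m : ℕ) (i : Fin n) : View n :=
  (fip fun _ => none).state α m i

/-- The local state of `i` at time `m` in a full-information protocol: its view, or `none` once it
has crashed. -/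
def localView (α : Adversary n) (i : Fin n) (m : ℕ) : Option (View n) :=
  (fip fun _ => none).localState α i m

theorem fip_state (rule : View n → Option (Fin 2)) (α : Adversary n) (m : ℕ) (i : Fin n) :
    (fip rule).state α m i = view α m i := by
  induction m generalizing i with
  | zero => rfl
  | succ m ih =>
    have h : (fip rule).state α m = (fip fun _ => none).state α m := funext ih
    unfold view Protocol.state
    rw [h]
    rfl

theorem view_proc_time (α : Adversary n) (m : ℕ) (i : Fin n) :
    (view α m i).proc = i ∧ (view α m i).time = m := by
  induction m generalizing i with
  | zero => exact ⟨rfl, rfl⟩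
  | succ m ih =>
    exact ⟨(ih i).1, congrArg (· + 1) (ih i).2⟩

/-! ### Knowledge, and the facts used in the protocols -/

/-- A process with local state `s` knows the fact `A` (among the full-information runs with at most
`t` crash failures): `A` holds, at the same time, against every adversary for which the process has
the same local state. -/
def Knows (t : ℕ) (A : Adversary n → ℕ → Prop) (s : View n) : Prop :=
  ∀ β : Adversary n, β.InCrash t → localView β s.proc s.time = some s → A β s.time

/-- Some process has input `v`. -/
def ExistsInput (v : Fin 2) (α : Adversary n) (_ : ℕ) : Prop :=
  ∃ j, α.input j = v

/-- No process that is active at time `m` knows that some process has input `v`. -/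
def NotKnownExists (t : ℕ) (v : Fin 2) (α : Adversary n) (m : ℕ) : Prop :=
  ∀ j, α.Active j m → ¬ Knows t (ExistsInput v) (view α m j)

/-- Some correct process knows, at time `m`, that some process has input `v`. -/
def ExistsCorrect (t : ℕ) (v : Fin 2) (α : Adversary n) (m : ℕ) : Prop :=
  ∃ j, α.Correct j ∧ Knows t (ExistsInput v) (view α m j)

/-- At least `n / 2` inputs are `0`. -/
def MajZero (α : Adversary n) (_ : ℕ) : Prop :=
  n ≤ 2 * {j | α.input j = 0}.ncard

/-- Strictly more than `n / 2` inputs are `1`. -/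
def MajOne (α : Adversary n) (_ : ℕ) : Prop :=
  n < 2 * {j | α.input j = 1}.ncard

/-- The processes whose input is known, in view `s`, to be `v`. -/
def knownInputs (t : ℕ) (v : Fin 2) (s : View n) : Set (Fin n) :=
  {j | Knows t (fun β _ => β.input j = v) s}

open scoped Classical in
/-- The majority among the known inputs: `0` if at least half of the processes whose input is known
have input `0`, and `1` otherwise. -/
def majVal (t : ℕ) (s : View n) : Fin 2 :=
  if (knownInputs t 0 s ∪ knownInputs t 1 s).ncard ≤ 2 * (knownInputs t 0 s).ncard then 0 else 1

/-- The node `(j, m)` is revealed to the process with view `s`: the node is seen, or a node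
`(i, m)` is seen that has not received the message sent by `j` in round `m` (so that `m ≥ 1`). -/
def NodeRevealed (s : View n) (j : Fin n) (m : ℕ) : Prop :=
  (j, m) ∈ s.nodes ∨
    ∃ k i, m = k + 1 ∧ (i, m) ∈ s.nodes ∧ ((j, k), (i, m)) ∉ s.edges

/-- Some time `k`, not later than the current one, is revealed: all its nodes are. -/
def SomeTimeRevealed (s : View n) : Prop :=
  ∃ k ≤ s.time, ∀ j, NodeRevealed s j k

/-! ### The protocols -/

/-- The protocol `Opt₀`. -/
def opt0 (n t : ℕ) : Protocol n :=
  fip fun s => zeroOneRule (Knows t (ExistsInput 0) s) (Knows t (NotKnownExists t 0) s)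

open scoped Classical in
/-- The protocol `Opt_Maj`. -/
def optMaj (n t : ℕ) : Protocol n :=
  fip fun s =>
    if Knows t MajZero s then some 0
    else if Knows t MajOne s then some 1
    else if SomeTimeRevealed s then some (majVal t s)
    else none

/-- The protocol `u-Opt₀`. -/
def uOpt0 (n t : ℕ) : Protocol n :=
  fip fun s => zeroOneRule (Knows t (ExistsCorrect t 0) s)
    (¬ Knows t (ExistsInput 0) s ∧ SomeTimeRevealed s)

end FullInformation

end

/-! Fix one of the three protocols `P` and a solution `Q` that last-decider dominates it. Everything
used about the domination is `DecidesNoLater`: if all active processes have decided by time `m`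
under `P`, then all correct ones have decided by time `m` under `Q`. By `ldUnbeatable_of` it then
suffices that `P` spreads (one round after a correct process decides, all active ones have decided)
and that a correct process decided under `Q` at time `m` is decided under `P` at time `m`. The
second point carries the work. Its method throughout is to pass from the given run to one that some
process cannot distinguish from it and in which `P` makes everybody decide at once. `Q` must then
decide there too, and validity and agreement determine the value. This transfer is sound for
arbitrary `Q` because the state of a process in any protocol is a function of its view
(`SameView.state_eq`).

For `Opt₀`: under `Q`, whoever has seen a `0` decides `0` immediately
(`decidedBy_zero_of_seesValue`, by induction on time). Hence a process can decide `1` only if it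
knows that no active process has seen a `0`.

For `Opt_Maj`: under `Q`, whoever sees a majority at time `0` or `1` decides on it immediately
(`decidedBy_zero_of_isMajority`, `decidedBy_one_of_isMajority`). The case of time `1` rests on
crash-free runs (`noCrash_decidedBy`), where minority inputs are flipped one at a time while a
single crash hides the flip. This is where `0 < t` enters. If a process decides with no majority
seen and no time revealed, then `exists_hidden_chain` supplies an indistinguishable run in which a
chain of hidden processes carries knowledge of the opposite majority up to the present, against
agreement.

For `u-Opt₀`: a decision on `0` requires knowing that a correct process has seen a `0`, since
otherwise all carriers of the `0` might crash (`DecidedBy.knows_existsCorrect`). The core is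
`decidedBy_zero_of_informers`: a process that has seen a `0` and hears from enough others in the
next round decides `0` under `Q`. It is proved with runs in which so few processes survive that
`u-Opt₀` decides at once. There, views can be exchanged one by one without affecting the decision.
Together with hidden chains this excludes premature decisions on `1`
(`not_decidedBy_one_of_hidden`). -/

/-! ### Views -/

/-- The node `(q, k)` lies in the view of `i` at time `m`. -/
def Sees {n : ℕ} (α : Adversary n) (k : ℕ) (q : Fin n) (m : ℕ) (i : Fin n) : Prop :=
  (q, k) ∈ (view α m i).nodes

/-- The processes whose input `i` has seen at time `m`. -/
def seenInputs {n : ℕ} (α : Adversary n) (m : ℕ) (i : Fin n) : Set (Fin n) :=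
  {q | Sees α 0 q m i}

/-- Process `i` has seen, at time `m`, an input `v`. -/
def SeesValue {n : ℕ} (α : Adversary n) (v : Fin 2) (m : ℕ) (i : Fin n) : Prop :=
  ∃ q, Sees α 0 q m i ∧ α.input q = v

/-- Process `i` has the same view at time `m` against `α` and against `β`. -/
def SameView {n : ℕ} (α β : Adversary n) : ℕ → Fin n → Prop
  | 0, i => α.input i = β.input i
  | m + 1, i => SameView α β m i ∧
      ∀ j, j ≠ i → (α.Edge m j i ↔ β.Edge m j i) ∧ (α.Edge m j i → SameView α β m j)

section Views

variable {n : ℕ} {α β γ : Adversary n} {i j q : Fin n} {k m : ℕ}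

open scoped Classical in
theorem view_succ (α : Adversary n) (m : ℕ) (i : Fin n) :
    view α (m + 1) i = nextView (view α m i)
      fun j => if j ≠ i ∧ α.Edge m j i then some (view α m j) else none := rfl

@[simp] theorem view_proc (α : Adversary n) (m : ℕ) (i : Fin n) : (view α m i).proc = i :=
  (view_proc_time α m i).1

@[simp] theorem view_time (α : Adversary n) (m : ℕ) (i : Fin n) : (view α m i).time = m :=
  (view_proc_time α m i).2

theorem sees_zero : Sees α k q 0 i ↔ q = i ∧ k = 0 := by
  simp [Sees, view, Protocol.state, fip, initialView]

theorem sees_succ : Sees α k q (m + 1) i ↔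
    (q = i ∧ k = m + 1) ∨ Sees α k q m i ∨ ∃ j, j ≠ i ∧ α.Edge m j i ∧ Sees α k q m j := by
  simp only [Sees, view_succ, nextView, view_proc, view_time]
  simp only [Set.mem_union, Set.mem_singleton_iff, Set.mem_ofPred_eq, Prod.mk.injEq, or_assoc,
    Option.ite_none_right_eq_some, Option.some.injEq]
  constructor
  · rintro (h | h | ⟨j, w, ⟨⟨h1, h2⟩, rfl⟩, h3⟩)
    exacts [Or.inl h, Or.inr (Or.inl h), Or.inr (Or.inr ⟨j, h1, h2, h3⟩)]
  · rintro (h | h | ⟨j, h1, h2, h3⟩)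
    exacts [Or.inl h, Or.inr (Or.inl h), Or.inr (Or.inr ⟨j, _, ⟨⟨h1, h2⟩, rfl⟩, h3⟩)]

theorem sees_self (α : Adversary n) (m : ℕ) (i : Fin n) : Sees α m i m i := by
  cases m with
  | zero => exact sees_zero.2 ⟨rfl, rfl⟩
  | succ m => exact sees_succ.2 (Or.inl ⟨rfl, rfl⟩)

theorem Sees.le (h : Sees α k q m i) : k ≤ m := by
  induction m generalizing i with
  | zero => exact (sees_zero.1 h).2.le
  | succ m ih =>
    rcases sees_succ.1 h with h | h | ⟨j, -, -, h⟩
    · exact h.2.le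
    · exact (ih h).trans (Nat.le_succ m)
    · exact (ih h).trans (Nat.le_succ m)

theorem Sees.succ (h : Sees α k q m i) : Sees α k q (m + 1) i :=
  sees_succ.2 (Or.inr (Or.inl h))

theorem Sees.edge (h : Sees α k q m j) (e : α.Edge m j i) : Sees α k q (m + 1) i := by
  by_cases hj : j = i
  · exact hj ▸ h.succ
  · exact sees_succ.2 (Or.inr (Or.inr ⟨j, hj, e, h⟩))

theorem Sees.mono {m' : ℕ} (h : Sees α k q m i) (hm : m ≤ m') : Sees α k q m' i := by
  induction hm with
  | refl => exact h
  | step _ ih => exact ih.succ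

theorem sees_own (α : Adversary n) (i : Fin n) (h : k ≤ m) : Sees α k i m i :=
  (sees_self α k i).mono h

theorem Sees.trans {k' : ℕ} {q' : Fin n} (h : Sees α k q m i) (h' : Sees α k' q' k q) :
    Sees α k' q' m i := by
  induction m generalizing i with
  | zero => obtain ⟨rfl, rfl⟩ := sees_zero.1 h; exact h'
  | succ m ih =>
    rcases sees_succ.1 h with ⟨rfl, rfl⟩ | h | ⟨j, -, e, h⟩
    · exact h'
    · exact (ih h).succ
    · exact (ih h).edge e

theorem Sees.prev (h : Sees α (k + 1) q m i) : Sees α k q m i :=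
  h.trans (sees_self α k q).succ

theorem Sees.prev_edge (h : Sees α (k + 1) q m i) (e : α.Edge k j q) : Sees α k j m i :=
  h.trans ((sees_self α k j).edge e)

theorem Sees.of_le {k' : ℕ} (h : Sees α k q m i) (hk : k' ≤ k) : Sees α k' q m i :=
  h.trans (sees_own α q hk)

theorem mem_edges_iff : ((j, k), (q, k + 1)) ∈ (view α m i).edges ↔
    Sees α (k + 1) q m i ∧ (j = q ∨ α.Edge k j q) := by
  induction m generalizing i with
  | zero =>
    simp [sees_zero, view, Protocol.state, fip, initialView]
  | succ m ih =>
    simp only [view_succ, nextView, view_proc, view_time]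
    simp only [Set.mem_union, Set.mem_ofPred_eq, Prod.mk.injEq, ih, sees_succ (m := m),
      Option.ite_none_right_eq_some, Option.some.injEq]
    constructor
    · rintro ((h | ⟨j', w, ⟨⟨h1, h2⟩, rfl⟩, h3⟩) | ⟨j', h1, ⟨rfl, rfl⟩, rfl, h3⟩)
      · exact ⟨Or.inr (Or.inl h.1), h.2⟩
      · rw [ih] at h3
        exact ⟨Or.inr (Or.inr ⟨j', h1, h2, h3.1⟩), h3.2⟩
      · refine ⟨Or.inl ⟨rfl, rfl⟩, ?_⟩
        rcases h1 with h1 | ⟨w, h1, -⟩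
        exacts [Or.inl h1, Or.inr h1.2]
    · rintro ⟨⟨rfl, h1⟩ | h1 | ⟨j', h1, h2, h3⟩, h4⟩
      · obtain rfl : k = m := by omega
        refine Or.inr ⟨j, ?_, ⟨rfl, rfl⟩, rfl, rfl⟩
        by_cases hj : j = q
        · exact Or.inl hj
        · exact Or.inr ⟨_, ⟨hj, h4.resolve_left hj⟩, rfl⟩
      · exact Or.inl (Or.inl ⟨h1, h4⟩)
      · exact Or.inl (Or.inr ⟨j', _, ⟨⟨h1, h2⟩, rfl⟩, ih.2 ⟨h3, h4⟩⟩)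

theorem mem_labels_iff {v : Fin 2} :
    (q, v) ∈ (view α m i).labels ↔ Sees α 0 q m i ∧ α.input q = v := by
  induction m generalizing i with
  | zero =>
    simp only [view, Protocol.state, fip, initialView, Set.mem_singleton_iff, Prod.mk.injEq,
      sees_zero, and_true]
    constructor
    · rintro ⟨rfl, rfl⟩; exact ⟨rfl, rfl⟩
    · rintro ⟨rfl, rfl⟩; exact ⟨rfl, rfl⟩
  | succ m ih =>
    simp only [view_succ, nextView]
    simp only [Set.mem_union, Set.mem_ofPred_eq, ih, sees_succ (m := m),
      Option.ite_none_right_eq_some, Option.some.injEq]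
    constructor
    · rintro (h | ⟨j', w, ⟨⟨h1, h2⟩, rfl⟩, h3⟩)
      · exact ⟨Or.inr (Or.inl h.1), h.2⟩
      · rw [ih] at h3
        exact ⟨Or.inr (Or.inr ⟨j', h1, h2, h3.1⟩), h3.2⟩
    · rintro ⟨⟨rfl, h1⟩ | h1 | ⟨j', h1, h2, h3⟩, h4⟩
      · omega
      · exact Or.inl ⟨h1, h4⟩
      · exact Or.inr ⟨j', _, ⟨⟨h1, h2⟩, rfl⟩, ih.2 ⟨h3, h4⟩⟩

theorem SameView.refl (α : Adversary n) (m : ℕ) (i : Fin n) : SameView α α m i := by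
  induction m generalizing i with
  | zero => rfl
  | succ m ih => exact ⟨ih i, fun j _ => ⟨Iff.rfl, fun _ => ih j⟩⟩

theorem SameView.symm (h : SameView α β m i) : SameView β α m i := by
  induction m generalizing i with
  | zero => exact Eq.symm h
  | succ m ih =>
    exact ⟨ih h.1, fun j hj => ⟨(h.2 j hj).1.symm, fun e => ih ((h.2 j hj).2 ((h.2 j hj).1.2 e))⟩⟩

theorem SameView.trans (h : SameView α β m i) (h' : SameView β γ m i) : SameView α γ m i := by
  induction m generalizing i with
  | zero => exact Eq.trans h h'
  | succ m ih =>
    exact ⟨ih h.1 h'.1, fun j hj => ⟨(h.2 j hj).1.trans (h'.2 j hj).1, fun e =>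
      ih ((h.2 j hj).2 e) ((h'.2 j hj).2 ((h.2 j hj).1.1 e))⟩⟩

theorem SameView.of_le (h : SameView α β m i) (hk : k ≤ m) : SameView α β k i := by
  induction hk with
  | refl => exact h
  | step _ ih => exact ih h.1

/-- A state depends only on the own input and on the messages received, directly or indirectly, and
the recursion of `SameView` records exactly these. Thus full-information indistinguishability
applies to every competitor `Q`. -/
theorem SameView.state_eq (P : Protocol n) (h : SameView α β m i) :
    P.state α m i = P.state β m i := by
  induction m generalizing i with
  | zero => exact congrArg (P.init i) h
  | succ m ih =>
    simp only [Protocol.state]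
    rw [ih h.1]
    congr 1
    funext j
    by_cases hj : j ≠ i
    · by_cases e : α.Edge m j i
      · simp [hj, e, (h.2 j hj).1.1 e, ih ((h.2 j hj).2 e)]
      · simp [e, mt (h.2 j hj).1.2 e]
    · simp [hj]

/-- The working criterion for indistinguishability: inputs and failures may be changed freely as
long as no seen input and no delivery to a seen node is affected. -/
theorem sameView_of_seen
    (h0 : ∀ q, Sees α 0 q m i → α.input q = β.input q)
    (h1 : ∀ k q, Sees α (k + 1) q m i → ∀ j, j ≠ q → (α.Edge k j q ↔ β.Edge k j q)) :
    SameView α β m i := by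
  suffices H : ∀ k q, Sees α k q m i → SameView α β k q from H m i (sees_self α m i)
  intro k
  induction k with
  | zero => exact h0
  | succ k ih =>
    exact fun q hq => ⟨ih q hq.prev, fun j hj =>
      ⟨h1 k q hq j hj, fun e => ih j (hq.prev_edge e)⟩⟩

/-- The labels and edges of a view determine the inputs seen and the deliveries at seen nodes, so
`sameView_of_seen` recovers the recursive relation from equality of views. -/
theorem sameView_iff_view_eq : SameView α β m i ↔ view α m i = view β m i := by
  refine ⟨fun h => h.state_eq _, fun h => sameView_of_seen (fun q hq => ?_) fun k q hq j hj => ?_⟩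
  · have := (mem_labels_iff (v := α.input q)).2 ⟨hq, rfl⟩
    rw [h, mem_labels_iff] at this
    exact this.2.symm
  · have hq' : Sees β (k + 1) q m i := by unfold Sees; rw [← h]; exact hq
    have a := mem_edges_iff (α := α) (j := j) (k := k) (q := q) (m := m) (i := i)
    have b := mem_edges_iff (α := β) (j := j) (k := k) (q := q) (m := m) (i := i)
    rw [h, b] at a
    simpa [hq, hq', hj] using a.symm

theorem SameView.sees (h : SameView α β m i) (hs : Sees α k q m i) : Sees β k q m i := by
  unfold Sees; rw [← sameView_iff_view_eq.1 h]; exact hs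

theorem SameView.of_sees (h : SameView α β m i) (hs : Sees α k q m i) : SameView α β k q := by
  induction m generalizing i with
  | zero => obtain ⟨rfl, rfl⟩ := sees_zero.1 hs; exact h
  | succ m ih =>
    rcases sees_succ.1 hs with ⟨rfl, rfl⟩ | hs | ⟨j, hj, e, hs⟩
    · exact h
    · exact ih h.1 hs
    · exact ih ((h.2 j hj).2 e) hs

theorem SameView.seesValue {v : Fin 2} (h : SameView α β m i) (hs : SeesValue α v m i) :
    SeesValue β v m i := by
  obtain ⟨q, hq, hv⟩ := hs
  exact ⟨q, h.sees hq, (show α.input q = β.input q from h.of_sees hq).symm.trans hv⟩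

theorem SeesValue.mono {v : Fin 2} {m' : ℕ} (h : SeesValue α v m i) (hm : m ≤ m') :
    SeesValue α v m' i := by
  obtain ⟨q, hq, hv⟩ := h
  exact ⟨q, hq.mono hm, hv⟩

theorem SeesValue.edge {v : Fin 2} (h : SeesValue α v m j) (e : α.Edge m j i) :
    SeesValue α v (m + 1) i := by
  obtain ⟨q, hq, hv⟩ := h
  exact ⟨q, hq.edge e, hv⟩

theorem SeesValue.exists_edge {v : Fin 2} (h : SeesValue α v (m + 1) i)
    (h' : ¬ SeesValue α v m i) : ∃ j, j ≠ i ∧ α.Edge m j i ∧ SeesValue α v m j := by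
  obtain ⟨q, hq, hv⟩ := h
  rcases sees_succ.1 hq with ⟨-, h0⟩ | hq | ⟨j, hj, e, hq⟩
  · omega
  · exact (h' ⟨q, hq, hv⟩).elim
  · exact ⟨j, hj, e, q, hq, hv⟩

end Views

/-! ### Activity and changes of the failure pattern -/

namespace Adversary

variable {n : ℕ} {α β : Adversary n} {i j p q : Fin n} {k m : ℕ}

theorem Active.mono (h : α.Active i m) (hk : k ≤ m) : α.Active i k :=
  le_trans (by exact_mod_cast hk) h

theorem Correct.active (h : α.Correct i) (m : ℕ) : α.Active i m := by
  unfold Active; rw [show α.crashTime i = ⊤ from h]; exact le_top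

theorem Edge.active (e : α.Edge m i j) : α.Active i m := by
  rcases e with h | h
  exacts [h.le, h.1.le]

theorem edge_of_active_succ (h : α.Active i (m + 1)) (j : Fin n) : α.Edge m i j :=
  Or.inl (lt_of_lt_of_le (by exact_mod_cast Nat.lt_succ_self m) h)

theorem edge_of_lt (h : α.Active i m) (hk : k < m) (j : Fin n) : α.Edge k i j :=
  edge_of_active_succ (h.mono hk) j

theorem Correct.edge (h : α.Correct i) (m : ℕ) (j : Fin n) : α.Edge m i j :=
  edge_of_active_succ (h.active _) j

theorem not_correct_of_not_edge (h : ¬ α.Edge m i j) : ¬ α.Correct i := fun c => h (c.edge m j)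

theorem exists_correct {t : ℕ} (ht : t < n) (h : α.InCrash t) : ∃ i, α.Correct i := by
  by_contra hc
  push Not at hc
  have : {i | ¬ α.Correct i} = Set.univ := Set.eq_univ_of_forall hc
  unfold InCrash at h
  rw [this, Set.ncard_univ, Nat.card_eq_fintype_card, Fintype.card_fin] at h
  omega

theorem InCrash.of_subset {t : ℕ} (h : α.InCrash t) (hs : ∀ i, α.Correct i → β.Correct i) :
    β.InCrash t :=
  (Set.ncard_le_ncard (Set.ofPred_subset_ofPred.2 fun i hi hc => hi (hs i hc))
    (Set.toFinite _)).trans h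

theorem InCrash.of_set {t : ℕ} (S : Set (Fin n)) (hS : S.ncard ≤ t)
    (h : ∀ i, i ∉ S → α.Correct i) : α.InCrash t :=
  (Set.ncard_le_ncard (fun i (hi : ¬ α.Correct i) => by_contra fun hc => hi (h i hc)) (Set.toFinite _)).trans hS

theorem InCrash.ncard_le {t : ℕ} (h : α.InCrash t) {S : Set (Fin n)}
    (hS : ∀ i ∈ S, ¬ α.Correct i) : S.ncard ≤ t :=
  (Set.ncard_le_ncard hS (Set.toFinite _)).trans h

open scoped Classical in
/-- The adversary that coincides with `α` up to time `m`; in the round that follows the active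
processes in `C` crash, and their messages reach only the processes in `L`; the remaining active
processes are correct. -/
noncomputable def extend (α : Adversary n) (m : ℕ) (C : Set (Fin n)) (L : Fin n → Set (Fin n)) :
    Adversary n where
  input := α.input
  crashTime p := if α.Active p m then (if p ∈ C then (m : ℕ∞) else ⊤) else α.crashTime p
  lastSent p := if α.Active p m then L p else α.lastSent p

/-- The adversary `α` with another input vector. -/
def withInput (α : Adversary n) (x : Fin n → Fin 2) : Adversary n := { α with input := x }

section Extend

variable {C : Set (Fin n)} {L : Fin n → Set (Fin n)}

open scoped Classical in
theorem extend_crashTime (α : Adversary n) (m : ℕ) (C : Set (Fin n)) (L : Fin n → Set (Fin n))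
    (p : Fin n) : (α.extend m C L).crashTime p =
      if α.Active p m then (if p ∈ C then (m : ℕ∞) else ⊤) else α.crashTime p := rfl

theorem extend_correct : (α.extend m C L).Correct p ↔ α.Active p m ∧ p ∉ C := by
  unfold Correct extend
  by_cases h : α.Active p m
  · by_cases hC : p ∈ C <;> simp [h, hC]
  · simp only [h, if_false, false_and, iff_false]
    intro h'
    exact h (by unfold Active; rw [h']; exact le_top)

theorem extend_active_of_le (hk : k ≤ m) : (α.extend m C L).Active p k ↔ α.Active p k := by
  by_cases h : α.Active p m
  · refine iff_of_true ?_ (h.mono hk)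
    unfold Active extend
    by_cases hC : p ∈ C
    · simpa [h, hC] using hk
    · simp [h, hC]
  · change (k : ℕ∞) ≤ (α.extend m C L).crashTime p ↔ (k : ℕ∞) ≤ α.crashTime p
    rw [extend_crashTime, if_neg h]

theorem extend_active_of_lt (hk : m < k) : (α.extend m C L).Active p k ↔ α.Active p m ∧ p ∉ C := by
  constructor
  · intro h
    have h1 : α.Active p m := (extend_active_of_le le_rfl).1 (h.mono hk.le)
    refine ⟨h1, fun hC => ?_⟩
    change (k : ℕ∞) ≤ (α.extend m C L).crashTime p at h
    rw [extend_crashTime, if_pos h1, if_pos hC] at h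
    exact absurd (by exact_mod_cast h) (not_le.2 hk)
  · exact fun h => (extend_correct.2 h).active k

theorem extend_edge_of_lt (hk : k < m) : (α.extend m C L).Edge k p q ↔ α.Edge k p q := by
  by_cases h : α.Active p m
  · exact iff_of_true (edge_of_lt ((extend_active_of_le le_rfl).2 h) hk q) (edge_of_lt h hk q)
  · simp [Edge, extend, h]

theorem extend_edge_self :
    (α.extend m C L).Edge m p q ↔ α.Active p m ∧ (p ∈ C → q ∈ L p) := by
  by_cases h : α.Active p m
  · by_cases hC : p ∈ C <;> simp [Edge, extend, h, hC]
  · simp only [h, false_and, iff_false]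
    exact fun e => h ((extend_active_of_le le_rfl).1 e.active)

theorem extend_edge_of_gt (hk : m < k) :
    (α.extend m C L).Edge k p q ↔ α.Active p m ∧ p ∉ C :=
  ⟨fun e => (extend_active_of_lt hk).1 e.active, fun h => (extend_correct.2 h).edge k q⟩

theorem extend_sameView (hk : k ≤ m) : SameView α (α.extend m C L) k p :=
  sameView_of_seen (fun _ _ => rfl) fun _ _ hq _ _ =>
    (extend_edge_of_lt (lt_of_lt_of_le (Nat.lt_succ_self _) (hq.le.trans hk))).symm

theorem InCrash.extend_empty {t : ℕ} (h : α.InCrash t) : (α.extend m ∅ L).InCrash t :=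
  h.of_subset fun i hi => extend_correct.2 ⟨hi.active m, Set.notMem_empty i⟩

end Extend

end Adversary

/-! ### Decisions -/

/-- In the run of `P` against `α`, process `i` has decided `v` by time `m`. -/
def DecidedBy {n : ℕ} (P : Protocol n) (α : Adversary n) (i : Fin n) (v : Fin 2) (m : ℕ) : Prop :=
  ∃ k ≤ m, P.DecidesAt α i v k

/-- Whenever all active processes have decided by time `m` in a run of `P`, all correct processes
have decided by time `m` in the corresponding run of `Q`. -/
def DecidesNoLater {n : ℕ} (t : ℕ) (Q P : Protocol n) : Prop :=
  ∀ β : Adversary n, β.InCrash t → ∀ m, (∀ i, β.Active i m → ∃ w, DecidedBy P β i w m) →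
    ∀ i, β.Correct i → ∃ w, DecidedBy Q β i w m

section Decisions

variable {n t : ℕ} {P Q : Protocol n} {α β : Adversary n} {i j : Fin n} {v w : Fin 2} {k m : ℕ}

theorem decidesAt_unique {m' : ℕ} (h : P.DecidesAt α i v m) (h' : P.DecidesAt α i w m') :
    v = w ∧ m = m' := by
  have e : m = m' := by
    rcases lt_trichotomy m m' with hm | hm | hm
    · have := h'.2.2 m hm
      rw [h.2.1] at this
      cases this
    · exact hm
    · have := h.2.2 m' hm
      rw [h'.2.1] at this
      cases this
  subst e
  exact ⟨Option.some.inj (h.2.1.symm.trans h'.2.1), rfl⟩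

theorem DecidedBy.decides (h : DecidedBy P α i v m) : P.Decides α i v :=
  let ⟨k, _, hk⟩ := h; ⟨k, hk⟩

theorem DecidedBy.mono (h : DecidedBy P α i v k) (hk : k ≤ m) : DecidedBy P α i v m :=
  let ⟨l, hl, h⟩ := h; ⟨l, hl.trans hk, h⟩

theorem decides_unique (h : P.Decides α i v) (h' : P.Decides α i w) : v = w :=
  let ⟨_, h⟩ := h; let ⟨_, h'⟩ := h'; (decidesAt_unique h h').1

theorem DecidedBy.congr (h : DecidedBy P α i v m) (hs : SameView α β m i) (hb : β.Active i m) :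
    DecidedBy P β i v m := by
  obtain ⟨k, hk, -, h2, h3⟩ := h
  refine ⟨k, hk, hb.mono hk, ?_, fun l hl => ?_⟩
  · rw [← (hs.of_le hk).state_eq]; exact h2
  · rw [← (hs.of_le (hl.le.trans hk)).state_eq]; exact h3 l hl

theorem exists_decidedBy (ha : α.Active i m) (h : P.decide (P.state α m i) ≠ none) :
    ∃ v, DecidedBy P α i v m := by
  classical
  have hex : ∃ k, P.decide (P.state α k i) ≠ none := ⟨m, h⟩
  have hle : Nat.find hex ≤ m := Nat.find_min' hex h
  obtain ⟨v, hv⟩ := Option.ne_none_iff_exists'.1 (Nat.find_spec hex)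
  exact ⟨v, Nat.find hex, hle, ha.mono hle, hv, fun k hk => not_not.1 (Nat.find_min hex hk)⟩

/-- Once all active processes have decided under `P` by time `m`, no later decision is possible, and
some correct process has decided. So the last decision of `P` among those counted by `who` exists
and is at most `m`. -/
theorem decidesNoLater_of_ldDominates {who : Adversary n → Fin n → Prop} (ht : t < n)
    (hwho : ∀ α i, α.Correct i → who α i) (hQ : ∀ α : Adversary n, α.InCrash t → Decision Q α)
    (h : LDDominates who t Q P) : DecidesNoLater t Q P := by
  classical
  intro β hβ m hm i hi
  have bound : ∀ l, (∃ j v, who β j ∧ P.DecidesAt β j v l) → l ≤ m := by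
    rintro l ⟨j, v, -, hj⟩
    by_contra hl
    push Not at hl
    obtain ⟨w, k, hk, hw⟩ := hm j (hj.1.mono hl.le)
    have := (decidesAt_unique hj hw).2
    omega
  obtain ⟨p, hp⟩ := Adversary.exists_correct ht hβ
  obtain ⟨u, k, hk, hu⟩ := hm p (hp.active m)
  have hex : ∃ j v, who β j ∧ P.DecidesAt β j v k := ⟨p, u, hwho β p hp, hu⟩
  set S : ℕ → Prop := fun l => ∃ j v, who β j ∧ P.DecidesAt β j v l with hS
  have hlast : IsLastDecisionTime who P β (Nat.findGreatest S m) :=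
    ⟨Nat.findGreatest_spec (P := S) hk hex, fun j v l hj hl =>
      Nat.le_findGreatest (bound l ⟨j, v, hj, hl⟩) ⟨j, v, hj, hl⟩⟩
  obtain ⟨w, l, hl⟩ := hQ β hβ i hi
  exact ⟨w, l, (h β hβ _ hlast i w l (hwho β i hi) hl).trans (Nat.findGreatest_le m), hl⟩

/-- Suppose the last decision of `Q` is at `m`, while `i` decides under `P` at `m' > m`. Then `i`
cannot have decided under `Q`. But a correct process has decided under `Q` by `m`, hence under `P`
by `m`. So all active processes have decided under `P` by `m + 1`, and the domination forces `i` to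
decide under `Q` by `m + 1 ≤ m'`. -/
theorem ldUnbeatable_of {who : Adversary n → Fin n → Prop}
    {S : Protocol n → Adversary n → Prop} (ht : t < n) (hwho : ∀ α i, α.Correct i → who α i)
    (hS : ∀ Q α, S Q α → Decision Q α) (solves : Solves S t P)
    (decided : ∀ Q, Solves S t Q → DecidesNoLater t Q P → ∀ α : Adversary n, α.InCrash t →
      ∀ i v m, α.Correct i → DecidedBy Q α i v m → ∃ w, DecidedBy P α i w m)
    (spread : ∀ α : Adversary n, α.InCrash t → ∀ p v m, α.Correct p → DecidedBy P α p v m →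
      ∀ i, α.Active i (m + 1) → ∃ w, DecidedBy P α i w (m + 1)) :
    LDUnbeatable who S t P := by
  refine ⟨solves, fun Q hQ hstrict => hstrict.2 ?_⟩
  have hfast := decidesNoLater_of_ldDominates ht hwho (fun α hα => hS Q α (hQ α hα)) hstrict.1
  intro α hα m hm i v m' hi hv
  by_contra hlt
  push Not at hlt
  -- The process `i` may crash after `m'`, whereas `hfast` speaks of correct processes only.
  -- Cancelling all later crashes makes `i` correct without changing any view up to `m'`.
  set β := α.extend m' ∅ fun _ => ∅ with hβ
  have hβc : β.InCrash t := hα.extend_empty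
  have hiβ : β.Correct i := Adversary.extend_correct.2 ⟨hv.1, Set.notMem_empty i⟩
  have same : ∀ k ≤ m', ∀ p, SameView α β k p := fun k hk p => Adversary.extend_sameView hk
  have hundec : ∀ w, ¬ DecidedBy Q β i w m' := by
    rintro w hw
    have hw' : DecidedBy Q α i w m' := hw.congr (same m' le_rfl i).symm hv.1
    obtain ⟨k, -, hk⟩ := hw'
    have hkm := hm.2 i w k hi hk
    obtain ⟨u, l, hl, hu⟩ := decided Q hQ hfast β hβc i w m hiβ
      (DecidedBy.congr ⟨k, hkm, hk⟩ (same m hlt.le i) (hiβ.active m))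
    have hu' := DecidedBy.congr ⟨l, hl, hu⟩ (same m hlt.le i).symm (hv.1.mono hlt.le)
    obtain ⟨l', hl', hu'⟩ := hu'
    have := (decidesAt_unique hu' hv).2
    omega
  obtain ⟨p, hp⟩ := Adversary.exists_correct ht hα
  have hpβ : β.Correct p := Adversary.extend_correct.2 ⟨hp.active m', Set.notMem_empty p⟩
  obtain ⟨w, k, hk⟩ := hS Q α (hQ α hα) p hp
  obtain ⟨u, hu⟩ := decided Q hQ hfast β hβc p w m hpβ
    (DecidedBy.congr ⟨k, hm.2 p w k (hwho α p hp) hk, hk⟩ (same m hlt.le p) (hpβ.active m))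
  obtain ⟨w', hw'⟩ := hfast β hβc (m + 1) (spread β hβc p u m hpβ hu) i hiβ
  exact hundec w' (hw'.mono hlt)

end Decisions

/-! ### Inputs -/

section Inputs

variable {n t : ℕ} {P Q : Protocol n} {α β : Adversary n} {i j : Fin n} {v w : Fin 2} {k m : ℕ}

theorem fin_two_eq_of_ne {a b v : Fin 2} (ha : a ≠ v) (hb : b ≠ v) : a = b := by omega

theorem exists_fin_two_ne (v : Fin 2) : ∃ w : Fin 2, w ≠ v := ⟨v + 1, by revert v; decide⟩

theorem sameView_withInput {x : Fin n → Fin 2} (h : ∀ q ∈ seenInputs α m i, α.input q = x q) :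
    SameView α (α.withInput x) m i :=
  sameView_of_seen h fun _ _ _ _ _ => Iff.rfl

/-- Processes that never crash decide only on values that they have seen. -/
theorem DecidedBy.seesValue (hQ : ∀ α : Adversary n, α.InCrash t → Validity Q α)
    (hα : α.InCrash t) (h : DecidedBy Q α i v m) (ha : α.Active i m) : SeesValue α v m i := by
  by_contra hs
  obtain ⟨w, hw⟩ := exists_fin_two_ne v
  -- If no input `v` is seen, all inputs may be the other value, and `i` may be correct. Validity
  -- then forbids `v`.
  set β := (α.extend m ∅ fun _ => ∅).withInput fun _ => w with hβdef
  have hβ : β.InCrash t :=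
    show (α.extend m ∅ fun _ => ∅).InCrash t from hα.extend_empty
  have hi : β.Correct i := show (α.extend m ∅ fun _ => ∅).Correct i from
    Adversary.extend_correct.2 ⟨ha, Set.notMem_empty i⟩
  have hsame : SameView α β m i := by
    refine (Adversary.extend_sameView le_rfl).trans (sameView_withInput fun q hq => ?_)
    have hq' : Sees α 0 q m i := (Adversary.extend_sameView le_rfl).symm.sees hq
    exact fin_two_eq_of_ne (fun e => hs ⟨q, hq', e⟩) hw
  exact hw (decides_unique (hQ β hβ w (fun _ => rfl) i hi)
    (h.congr hsame (hi.active m)).decides)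

end Inputs

/-! ### Knowledge -/

section Knowledge

variable {n t : ℕ} {α β : Adversary n} {i j q : Fin n} {v w : Fin 2} {k m : ℕ}
  {A : Adversary n → ℕ → Prop}

open scoped Classical in
theorem knows_iff : Knows t A (view α m i) ↔
    ∀ β : Adversary n, β.InCrash t → β.Active i m → SameView α β m i → A β m := by
  have key : ∀ β : Adversary n, localView β i m = some (view α m i) ↔
      β.Active i m ∧ SameView α β m i := by
    intro β
    rw [sameView_iff_view_eq, eq_comm (a := view α m i)]
    have e : localView β i m = if β.Active i m then some (view β m i) else none := rfl
    rw [e, Option.ite_none_right_eq_some, Option.some.injEq]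
  unfold Knows
  rw [view_proc, view_time]
  simp only [key, and_imp]

theorem Knows.holds (h : Knows t A (view α m i)) (hα : α.InCrash t) (ha : α.Active i m) : A α m :=
  knows_iff.1 h α hα ha (SameView.refl α m i)

/-- A stable fact that is known to a process is known, one round later, to all processes that it
informs. -/
theorem Knows.edge (hA : ∀ β : Adversary n, β.InCrash t → A β m → A β (m + 1))
    (h : Knows t A (view α m j)) (e : α.Edge m j i) : Knows t A (view α (m + 1) i) := by
  rw [knows_iff] at h ⊢
  intro β hβ ha hs
  refine hA β hβ (h β hβ ?_ ?_)
  · by_cases hj : j = i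
    · exact hj ▸ ha.mono (Nat.le_succ m)
    · exact ((hs.2 j hj).1.1 e).active
  · by_cases hj : j = i
    · exact hj ▸ hs.1
    · exact (hs.2 j hj).2 e

/-- If `v` has not been seen, every unseen input may be replaced by the other value without changing
the view. -/
theorem knows_existsInput_iff (hα : α.InCrash t) (ha : α.Active i m) :
    Knows t (ExistsInput v) (view α m i) ↔ SeesValue α v m i := by
  rw [knows_iff]
  constructor
  · intro h
    by_contra hs
    obtain ⟨w, hw⟩ := exists_fin_two_ne v
    obtain ⟨j, hj⟩ := h (α.withInput fun _ => w) hα ha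
      (sameView_withInput fun q hq => fin_two_eq_of_ne (fun e => hs ⟨q, hq, e⟩) hw)
    exact hw hj
  · rintro ⟨q, hq, hv⟩ β - - hs
    exact ⟨q, (show α.input q = β.input q from hs.of_sees hq).symm.trans hv⟩

/-- The processes that are seen to have input `v`. -/
def seenWithInput {n : ℕ} (α : Adversary n) (v : Fin 2) (m : ℕ) (i : Fin n) : Set (Fin n) :=
  {q | Sees α 0 q m i ∧ α.input q = v}

theorem knownInputs_view (hα : α.InCrash t) (ha : α.Active i m) :
    knownInputs t v (view α m i) = seenWithInput α v m i := by
  ext q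
  change Knows t (fun β _ => β.input q = v) (view α m i) ↔ Sees α 0 q m i ∧ α.input q = v
  rw [knows_iff]
  constructor
  · intro h
    refine ⟨?_, h α hα ha (SameView.refl α m i)⟩
    by_contra hq
    obtain ⟨w, hw⟩ := exists_fin_two_ne v
    refine hw ?_
    have := h (α.withInput (Function.update α.input q w)) hα ha
      (sameView_withInput fun p hp => by
        rw [Function.update_of_ne]
        rintro rfl
        exact hq hp)
    simpa [Adversary.withInput] using this
  · rintro ⟨hq, hv⟩ β - - hs
    exact (show α.input q = β.input q from hs.of_sees hq).symm.trans hv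

theorem SameView.seenWithInput_eq (h : SameView α β m i) :
    seenWithInput α v m i = seenWithInput β v m i := by
  ext q
  constructor
  · rintro ⟨hq, hv⟩
    exact ⟨h.sees hq, (show α.input q = β.input q from h.of_sees hq).symm.trans hv⟩
  · rintro ⟨hq, hv⟩
    exact ⟨h.symm.sees hq, (show β.input q = α.input q from h.symm.of_sees hq).symm.trans hv⟩

end Knowledge

/-! ### Revealed times -/

section Revealed

variable {n t : ℕ} {α β : Adversary n} {i j q : Fin n} {v w : Fin 2} {k m : ℕ}

theorem nodeRevealed_iff : NodeRevealed (view α m i) q k ↔ Sees α k q m i ∨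
    ∃ l p, k = l + 1 ∧ Sees α (l + 1) p m i ∧ p ≠ q ∧ ¬ α.Edge l q p := by
  unfold NodeRevealed
  refine or_congr Iff.rfl ⟨?_, ?_⟩
  · rintro ⟨l, p, rfl, h1, h2⟩
    rw [mem_edges_iff] at h2
    push Not at h2
    exact ⟨l, p, rfl, h1, (h2 h1).1.symm, (h2 h1).2⟩
  · rintro ⟨l, p, rfl, h1, h2, h3⟩
    refine ⟨l, p, rfl, h1, ?_⟩
    rw [mem_edges_iff]
    rintro ⟨-, h | h⟩
    exacts [h2 h.symm, h3 h]

theorem someTimeRevealed_iff : SomeTimeRevealed (view α m i) ↔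
    ∃ k ≤ m, ∀ j, NodeRevealed (view α m i) j k := by
  unfold SomeTimeRevealed
  rw [view_time]

theorem SomeTimeRevealed.edge (h : SomeTimeRevealed (view α m j)) (e : α.Edge m j i) :
    SomeTimeRevealed (view α (m + 1) i) := by
  rw [someTimeRevealed_iff] at h ⊢
  obtain ⟨k, hk, h⟩ := h
  refine ⟨k, hk.trans (Nat.le_succ m), fun q => ?_⟩
  have := h q
  rw [nodeRevealed_iff] at this ⊢
  rcases this with h | ⟨l, p, h1, h2, h3⟩
  exacts [Or.inl (h.edge e), Or.inr ⟨l, p, h1, h2.edge e, h3⟩]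

/-- What is seen of time `0` at time `m` was seen by a process active at an intermediate time. -/
theorem Sees.through (h : Sees α 0 q m i) (ha : α.Active i m) (hk : k ≤ m) :
    ∃ p, α.Active p k ∧ Sees α 0 q k p ∧ Sees α k p m i := by
  induction m generalizing i with
  | zero =>
    obtain rfl : k = 0 := by omega
    exact ⟨i, ha, h, sees_self α 0 i⟩
  | succ m ih =>
    rcases hk.lt_or_eq with hk | rfl
    · have hk : k ≤ m := by omega
      rcases sees_succ.1 h with ⟨-, h0⟩ | h | ⟨j, hj, e, h⟩
      · omega
      · obtain ⟨p, h1, h2, h3⟩ := ih h (ha.mono (Nat.le_succ m)) hk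
        exact ⟨p, h1, h2, h3.succ⟩
      · obtain ⟨p, h1, h2, h3⟩ := ih h e.active hk
        exact ⟨p, h1, h2, h3.edge e⟩
    · exact ⟨i, ha, h, sees_self α _ i⟩

/-- Information about inputs reaches a time `l ≥ k` only through processes active at time `k`. Such
a process has delivered its messages of round `k`, so its node cannot be revealed by a missing
message. The node is therefore seen, together with all the inputs it knows. -/
theorem SomeTimeRevealed.exists_time (h : SomeTimeRevealed (view α m i)) :
    ∃ k ≤ m, ∀ l, k ≤ l → ∀ j, α.Active j l → seenInputs α l j ⊆ seenInputs α m i := by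
  obtain ⟨k, hk, h⟩ := someTimeRevealed_iff.1 h
  refine ⟨k, hk, fun l hl j hj q hq => ?_⟩
  obtain ⟨p, hp, h1, h2⟩ := Sees.through hq hj hl
  rcases nodeRevealed_iff.1 (h p) with h3 | ⟨c, r, rfl, h3, h4, h5⟩
  · exact h3.trans h1
  · exact (h5 (Adversary.edge_of_active_succ hp r)).elim

theorem SomeTimeRevealed.seenInputs_subset (h : SomeTimeRevealed (view α m i))
    (hj : α.Correct j) (l : ℕ) : seenInputs α l j ⊆ seenInputs α m i := by
  obtain ⟨k, -, h⟩ := h.exists_time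
  intro q hq
  exact h (max k l) (le_max_left k l) j (hj.active _) (hq.mono (le_max_right k l))

/-- With at most `t` crashes, some time is revealed to each correct process at time `t + 1`. -/
theorem someTimeRevealed_of_correct (hα : α.InCrash t) (hi : α.Correct i) :
    SomeTimeRevealed (view α (t + 1) i) := by
  classical
  -- For a faulty `j` this is the first time whose message from `j` to `i` is lost. At any other
  -- time `c`, either the message sent at `c` arrives, so that the node is seen, or the one sent at
  -- `c - 1` is already lost, which reveals the node. Each faulty process thus spoils one time, and
  -- one of the `t + 1` times `0, …, t` remains.
  let blocked : Fin n → ℕ := fun j =>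
    if i ∈ α.lastSent j then (α.crashTime j).toNat + 1 else (α.crashTime j).toNat
  obtain ⟨c, hc, hfree⟩ : ∃ c ∈ Finset.range (t + 1),
      c ∉ Finset.image blocked {j | ¬ α.Correct j} := by
    apply Finset.exists_mem_notMem_of_card_lt_card
    refine lt_of_le_of_lt Finset.card_image_le ?_
    rw [Finset.card_range, Nat.lt_succ_iff]
    unfold Adversary.InCrash at hα
    rw [Set.ncard_eq_toFinset_card'] at hα
    convert hα using 2
    ext; simp
  have hct : c ≤ t := by simpa [Nat.lt_succ_iff] using hc
  rw [someTimeRevealed_iff]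
  refine ⟨c, by omega, fun j => nodeRevealed_iff.2 ?_⟩
  by_cases hedge : α.Edge c j i
  · exact Or.inl (((sees_self α c j).edge hedge).mono (by omega))
  have hj : ¬ α.Correct j := Adversary.not_correct_of_not_edge hedge
  have hji : i ≠ j := fun h => hj (h ▸ hi)
  have hb : blocked j ≠ c := fun e => hfree (Finset.mem_image.2 ⟨j, by simpa using hj, e⟩)
  obtain ⟨d, hd⟩ := ENat.ne_top_iff_exists.1 hj
  have hbd : blocked j = if i ∈ α.lastSent j then d + 1 else d := by simp [blocked, ← hd]
  unfold Adversary.Edge at hedge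
  rw [← hd] at hedge
  simp only [Nat.cast_lt, Nat.cast_inj, not_or, not_lt, not_and] at hedge
  right
  obtain ⟨l, rfl⟩ : ∃ l, c = l + 1 := by
    refine ⟨c - 1, ?_⟩
    by_cases hl : i ∈ α.lastSent j
    · have := hedge.2
      by_contra hne
      obtain rfl : c = 0 := by omega
      obtain rfl : d = 0 := by omega
      exact this rfl hl
    · rw [if_neg hl] at hbd
      omega
  refine ⟨l, i, rfl, sees_own α i (by omega), hji, ?_⟩
  unfold Adversary.Edge
  rw [← hd]
  simp only [Nat.cast_lt, Nat.cast_inj, not_or, not_lt, not_and]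
  by_cases hl : i ∈ α.lastSent j
  · rw [if_pos hl] at hbd
    have : l + 1 ≠ d := fun e => hedge.2 e hl
    exact ⟨by omega, by omega⟩
  · rw [if_neg hl] at hbd
    exact ⟨by omega, fun _ => hl⟩

end Revealed

/-! ### Rounds in which the processes that do not inform a given process are silent -/

namespace Adversary

/-- The processes that do not inform `j` in the round after time `m`. -/
def Missing {n : ℕ} (α : Adversary n) (m : ℕ) (j : Fin n) : Set (Fin n) :=
  {p | p ≠ j ∧ ¬ α.Edge m p j}

/-- The adversary that coincides with `α` up to time `m`; in the round that follows, the active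
processes that do not inform `j` crash, and the message of `p` reaches only the processes other
than `j` in `L p`; all other active processes are correct. -/
noncomputable def confirm {n : ℕ} (α : Adversary n) (m : ℕ) (j : Fin n)
    (L : Fin n → Set (Fin n)) : Adversary n :=
  α.extend m (α.Missing m j) fun p => L p \ {j}

variable {n t : ℕ} {α : Adversary n} {i j p : Fin n} {k m : ℕ} {L : Fin n → Set (Fin n)}

theorem Missing.not_correct (h : p ∈ α.Missing m j) : ¬ α.Correct p :=
  not_correct_of_not_edge h.2

theorem confirm_correct_self (h : α.Active j m) : (α.confirm m j L).Correct j :=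
  extend_correct.2 ⟨h, fun h => h.1 rfl⟩

theorem confirm_correct (h : α.Edge m p j) : (α.confirm m j L).Correct p :=
  extend_correct.2 ⟨h.active, fun h' => h'.2 h⟩

theorem confirm_inCrash (h : α.InCrash t) : (α.confirm m j L).InCrash t :=
  h.of_subset fun _ hp => confirm_correct (hp.edge m j)

theorem confirm_sameView (hk : k ≤ m) : SameView α (α.confirm m j L) k p := extend_sameView hk

theorem confirm_sameView_succ : SameView α (α.confirm m j L) (m + 1) j := by
  refine ⟨confirm_sameView le_rfl, fun p hp => ⟨⟨fun e => (confirm_correct e).edge m j, ?_⟩,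
    fun _ => confirm_sameView le_rfl⟩⟩
  intro e
  by_contra h
  exact ((extend_edge_self.1 e).2 ⟨hp, h⟩).2 rfl

end Adversary

/-! ### Full-information protocols -/

section Rules

variable {n t : ℕ} {α : Adversary n} {i j : Fin n} {v : Fin 2} {k m : ℕ}
  {rule : View n → Option (Fin 2)}

theorem exists_decidedBy_fip (ha : α.Active i m) (h : rule (view α m i) ≠ none) :
    ∃ w, DecidedBy (fip rule) α i w m :=
  exists_decidedBy ha (by rw [fip_state]; exact h)

theorem rule_of_decidesAt_fip (h : (fip rule).DecidesAt α i v m) :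
    rule (view α m i) = some v := by
  have := h.2.1
  rw [fip_state] at this
  exact this

theorem zeroOneRule_eq_zero {A B : Prop} (h : zeroOneRule A B = some 0) : A := by
  unfold zeroOneRule at h
  split_ifs at h with h1 h2
  · exact h1
  · simp at h

theorem zeroOneRule_eq_one {A B : Prop} (h : zeroOneRule A B = some 1) : ¬ A ∧ B := by
  unfold zeroOneRule at h
  split_ifs at h with h1 h2
  · simp at h
  · exact ⟨h1, h2⟩

theorem zeroOneRule_ne_none {A B : Prop} (h : A ∨ B) : zeroOneRule A B ≠ none := by
  unfold zeroOneRule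
  split_ifs with h1 h2
  · simp
  · simp
  · exact absurd h (not_or.2 ⟨h1, h2⟩)

theorem SeesValue.through {v : Fin 2} (h : SeesValue α v m i) (ha : α.Active i m) (hk : k ≤ m) :
    ∃ p, α.Active p k ∧ SeesValue α v k p := by
  obtain ⟨q, hq, hv⟩ := h
  obtain ⟨p, h1, h2, -⟩ := hq.through ha hk
  exact ⟨p, h1, q, h2, hv⟩

theorem SomeTimeRevealed.seesValue (h : SomeTimeRevealed (view α m i)) (hj : α.Correct j)
    (hv : SeesValue α v k j) : SeesValue α v m i := by
  obtain ⟨q, hq, hv⟩ := hv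
  exact ⟨q, h.seenInputs_subset hj k hq, hv⟩

theorem SomeTimeRevealed.seesValue_of_le (h : SomeTimeRevealed (view α m i))
    (hj : α.Active j k) (hk : m ≤ k) (hv : SeesValue α v k j) : SeesValue α v m i := by
  obtain ⟨q, hq, hv⟩ := hv
  obtain ⟨l, hl, h⟩ := h.exists_time
  exact ⟨q, h k (hl.trans hk) j hj hq, hv⟩

end Rules

/-! ### The protocol `Opt₀` -/

section OptZero

variable {n t : ℕ} {Q : Protocol n} {α : Adversary n} {i j : Fin n} {v : Fin 2} {k m : ℕ}

theorem NotKnownExists.not_seesValue (h : NotKnownExists t v α k) (hα : α.InCrash t) (hk : k ≤ m)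
    (hi : α.Active i m) : ¬ SeesValue α v m i := by
  intro hs
  obtain ⟨p, hp, hs⟩ := hs.through hi hk
  exact h p hp ((knows_existsInput_iff hα hp).2 hs)

theorem NotKnownExists.mono (h : NotKnownExists t v α k) (hα : α.InCrash t) (hk : k ≤ m) :
    NotKnownExists t v α m := fun _ hj hkn =>
  h.not_seesValue hα hk hj ((knows_existsInput_iff hα hj).1 hkn)

/-- A revealed time is a property of the view, so it is revealed in every indistinguishable run, and
there no active process has seen an input that `i` has not. -/
theorem knows_notKnownExists (h : SomeTimeRevealed (view α m i)) (hs : ¬ SeesValue α v m i) :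
    Knows t (NotKnownExists t v) (view α m i) := by
  rw [knows_iff]
  intro β hβ _ hsame j hj hkn
  rw [sameView_iff_view_eq.1 hsame] at h
  exact hs (hsame.symm.seesValue (h.seesValue_of_le hj le_rfl
    ((knows_existsInput_iff hβ hj).1 hkn)))

theorem opt0_exists_decidedBy (hα : α.InCrash t) (ha : α.Active i m)
    (h : SeesValue α 0 m i ∨ Knows t (NotKnownExists t 0) (view α m i)) :
    ∃ w, DecidedBy (opt0 n t) α i w m :=
  exists_decidedBy_fip ha (zeroOneRule_ne_none (h.imp_left (knows_existsInput_iff hα ha).2))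

theorem opt0_decidesAt_zero (hα : α.InCrash t) (h : (opt0 n t).DecidesAt α i 0 m) :
    SeesValue α 0 m i :=
  (knows_existsInput_iff hα h.1).1 (zeroOneRule_eq_zero (rule_of_decidesAt_fip h))

theorem opt0_decidesAt_one (hα : α.InCrash t) (h : (opt0 n t).DecidesAt α i 1 m) :
    ¬ SeesValue α 0 m i ∧ Knows t (NotKnownExists t 0) (view α m i) :=
  (zeroOneRule_eq_one (rule_of_decidesAt_fip h)).imp_left
    (mt (knows_existsInput_iff hα h.1).2)

theorem opt0_solves : Solves Consensus t (opt0 n t) := by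
  intro α hα
  have dec : Decision (opt0 n t) α := by
    intro i hi
    obtain ⟨w, hw⟩ := opt0_exists_decidedBy (m := t + 1) hα (hi.active _) (or_iff_not_imp_left.2
      fun hs => knows_notKnownExists (someTimeRevealed_of_correct hα hi) hs)
    exact ⟨w, hw.decides⟩
  have agree : ∀ i j, α.Correct i → α.Correct j → (opt0 n t).Decides α i 0 →
      ¬ (opt0 n t).Decides α j 1 := by
    rintro i j hi hj ⟨m, hm⟩ ⟨m', hm'⟩
    have h1 := (opt0_decidesAt_one hα hm').2.holds hα (hj.active m')
    exact h1.not_seesValue hα (le_max_right m m') (hi.active _)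
      ((opt0_decidesAt_zero hα hm).mono (le_max_left m m'))
  refine ⟨dec, fun v hv i hi => ?_, fun i j v w hi hj h1 h2 => ?_⟩
  · obtain ⟨w, m, hw⟩ := dec i hi
    have hs : ∀ u, SeesValue α u m i → u = v := by
      rintro u ⟨q, -, hu⟩
      exact hu.symm.trans (hv q)
    match w, hw with
    | 0, hw => exact hs 0 (opt0_decidesAt_zero hα hw) ▸ ⟨m, hw⟩
    | 1, hw =>
      have h1 : v ≠ 0 := fun e => (opt0_decidesAt_one hα hw).1
        ⟨i, sees_own α i (Nat.zero_le m), (hv i).trans e⟩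
      obtain rfl : v = 1 := by omega
      exact ⟨m, hw⟩
  · match v, w, h1, h2 with
    | 0, 0, _, _ => rfl
    | 1, 1, _, _ => rfl
    | 0, 1, h1, h2 => exact (agree i j hi hj h1 h2).elim
    | 1, 0, h1, h2 => exact (agree j i hj hi h2 h1).elim

theorem opt0_spread (hα : α.InCrash t) (hj : α.Correct j) (h : DecidedBy (opt0 n t) α j v m)
    (hi : α.Active i (m + 1)) : ∃ w, DecidedBy (opt0 n t) α i w (m + 1) := by
  obtain ⟨k, hk, h⟩ := h
  have hk1 : k + 1 ≤ m + 1 := by omega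
  have key : SeesValue α 0 (k + 1) i ∨ Knows t (NotKnownExists t 0) (view α (k + 1) i) := by
    match v, h with
    | 0, h => exact Or.inl ((opt0_decidesAt_zero hα h).edge (hj.edge k i))
    | 1, h => exact Or.inr ((opt0_decidesAt_one hα h).2.edge
        (fun β hβ hk => hk.mono hβ (Nat.le_succ k)) (hj.edge k i))
  obtain ⟨w, hw⟩ := opt0_exists_decidedBy hα (hi.mono hk1) key
  exact ⟨w, hw.mono hk1⟩

/-- In a solution that never takes its last decision later than `Opt₀`, a process that has seen
a `0` decides `0` at once. -/
theorem decidedBy_zero_of_seesValue (hQ : Solves Consensus t Q)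
    (hf : DecidesNoLater t Q (opt0 n t)) (hα : α.InCrash t) (hi : α.Active i m)
    (hs : SeesValue α 0 m i) : DecidedBy Q α i 0 m := by
  induction m generalizing α i with
  | zero =>
    -- At time `0` only the own input, which is `0`, is visible. With all inputs `0`, `Opt₀` decides
    -- everywhere at once and validity gives the value.
    set β := (α.extend 0 ∅ fun _ => ∅).withInput fun _ => 0 with hβdef
    have hβ : β.InCrash t := show (α.extend 0 ∅ fun _ => ∅).InCrash t from hα.extend_empty
    have hiβ : β.Correct i := show (α.extend 0 ∅ fun _ => ∅).Correct i from
      Adversary.extend_correct.2 ⟨hi, Set.notMem_empty i⟩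
    obtain ⟨w, hw⟩ := hf β hβ 0 (fun j hj => opt0_exists_decidedBy hβ hj
      (Or.inl ⟨j, sees_self β 0 j, rfl⟩)) i hiβ
    obtain rfl := decides_unique hw.decides ((hQ β hβ).2.1 0 (fun _ => rfl) i hiβ)
    refine hw.congr ?_ hi
    obtain ⟨q, hq, h0⟩ := hs
    obtain ⟨rfl, -⟩ := sees_zero.1 hq
    exact h0.symm
  | succ m ih =>
    by_cases hm : SeesValue α 0 m i
    · exact (ih hα (hi.mono (Nat.le_succ m)) hm).mono (Nat.le_succ m)
    obtain ⟨j, hj, e, hs⟩ := hs.exists_edge hm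
    -- Here the informer `j` is correct, so everybody has seen the `0` at time `m + 1` and `Opt₀` is
    -- finished. Thus `i` must decide under `Q`, in agreement with `j`.
    set β := α.confirm m i fun _ => ∅ with hβdef
    have hβ : β.InCrash t := Adversary.confirm_inCrash hα
    have hiβ : β.Correct i := Adversary.confirm_correct_self (hi.mono (Nat.le_succ m))
    have hjβ : β.Correct j := Adversary.confirm_correct e
    have hsβ : SeesValue β 0 m j := (Adversary.confirm_sameView le_rfl).seesValue hs
    obtain ⟨w, hw⟩ := hf β hβ (m + 1) (fun p hp => opt0_exists_decidedBy hβ hp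
      (Or.inl (hsβ.edge (hjβ.edge m p)))) i hiβ
    obtain rfl := (hQ β hβ).2.2 i j w 0 hiβ hjβ hw.decides
      (ih hβ (hjβ.active m) hsβ).decides
    exact hw.congr Adversary.confirm_sameView_succ.symm hi

/-- For a decision on `1`: an active process that may have seen a `0` would already have decided
`0`, and both processes may turn out to be correct. -/
theorem opt0_decided (hQ : Solves Consensus t Q) (hf : DecidesNoLater t Q (opt0 n t))
    (hα : α.InCrash t) (hi : α.Active i m) (h : DecidedBy Q α i v m) :
    ∃ w, DecidedBy (opt0 n t) α i w m := by
  refine opt0_exists_decidedBy hα hi ?_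
  match v, h with
  | 0, h => exact Or.inl (h.seesValue (fun β hβ => (hQ β hβ).2.1) hα hi)
  | 1, h =>
    refine Or.inr (knows_iff.2 fun β hβ ha hs j hj hkn => ?_)
    rw [knows_existsInput_iff hβ hj] at hkn
    set γ := β.extend m ∅ fun _ => ∅ with hγdef
    have hγ : γ.InCrash t := hβ.extend_empty
    have same : ∀ p, SameView β γ m p := fun p => Adversary.extend_sameView le_rfl
    have hiγ : γ.Correct i := Adversary.extend_correct.2 ⟨ha, Set.notMem_empty i⟩
    have hjγ : γ.Correct j := Adversary.extend_correct.2 ⟨hj, Set.notMem_empty j⟩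
    have h0 := decidedBy_zero_of_seesValue hQ hf hγ (hjγ.active m) ((same j).seesValue hkn)
    have h1 := h.congr (hs.trans (same i)) (hiγ.active m)
    exact absurd ((hQ γ hγ).2.2 j i 0 1 hjγ hiγ h0.decides h1.decides) (by decide)

theorem opt0_ldUnbeatable {who : Adversary n → Fin n → Prop} (ht : t < n)
    (hwho : ∀ α i, α.Correct i → who α i) : LDUnbeatable who Consensus t (opt0 n t) :=
  ldUnbeatable_of ht hwho (fun _ _ h => h.1) opt0_solves
    (fun _ hQ hf _ hα _ _ m hi h => opt0_decided hQ hf hα (hi.active m) h)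
    fun _ hα _ _ _ hp h _ hi => opt0_spread hα hp h hi

end OptZero

/-! ### Hidden chains -/

section Hidden

variable {n t : ℕ} {α : Adversary n} {i : Fin n} {m : ℕ}

/-- If no time is revealed to `i`, then there may be a chain of processes, hidden from `i`, along
which arbitrary unseen inputs are transmitted up to the present. -/
theorem exists_hidden_chain (hα : α.InCrash t) (hi : α.Active i m) (hm : 1 ≤ m)
    (hr : ¬ SomeTimeRevealed (view α m i)) (x : Fin n → Fin 2)
    (hx : ∀ q ∈ seenInputs α m i, α.input q = x q) :
    ∃ (β : Adversary n) (h : ℕ → Fin n), β.input = x ∧ β.InCrash t ∧ β.Active i m ∧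
      SameView α β m i ∧ h 0 ∉ seenInputs α m i ∧ β.Correct (h m) ∧ (∀ k ≤ m, h k ≠ i) ∧
      (∀ k < m, h k ≠ h (k + 1) ∧ β.Edge k (h k) (h (k + 1)) ∧ ¬ β.Edge k (h k) i) ∧
      ∀ q, q ≠ h 1 → β.Edge 0 q (h 1) := by
  classical
  rw [someTimeRevealed_iff] at hr
  push Not at hr
  have hex : ∀ k, ∃ j, k ≤ m → ¬ NodeRevealed (view α m i) j k := fun k => by
    by_cases hk : k ≤ m
    · exact (hr k hk).imp fun j hj _ => hj
    · exact ⟨i, fun h => (hk h).elim⟩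
  choose h hh using hex
  have unseen : ∀ k ≤ m, ¬ Sees α k (h k) m i := fun k hk hs =>
    hh k hk (nodeRevealed_iff.2 (Or.inl hs))
  have hne : ∀ k ≤ m, h k ≠ i := fun k hk e => unseen k hk (e ▸ sees_own α i hk)
  have reach : ∀ k l y, k = l + 1 → k ≤ m → Sees α (l + 1) y m i → y ≠ h k →
      α.Edge l (h k) y := fun k l y e hk hs hy => by_contra fun hc =>
    hh k hk (nodeRevealed_iff.2 (Or.inr ⟨l, y, e, hs, hy, hc⟩))
  -- Since the node `(h k, k)` is neither seen nor revealed by a lost message, as far as `i` can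
  -- tell `h k` sends properly before time `k` (this) and not at all from time `k` on (`late`). The
  -- two behaviours exclude each other, so the `h k` are distinct.
  have early : ∀ k ≤ m, ∀ l < k, ∀ y, Sees α (l + 1) y m i → y ≠ h k → α.Edge l (h k) y := by
    intro k hk l hl y hs hy
    obtain ⟨c, rfl⟩ : ∃ c, k = c + 1 := ⟨k - 1, by omega⟩
    rcases (Nat.lt_succ_iff.1 hl).lt_or_eq with hl | rfl
    · exact Adversary.edge_of_lt
        (reach _ c i rfl hk (sees_own α i hk) (hne _ hk).symm).active hl y
    · exact reach _ l y rfl hk hs hy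
  have late : ∀ k ≤ m, ∀ l, k ≤ l → ∀ y, Sees α (l + 1) y m i → ¬ α.Edge l (h k) y :=
    fun k hk l hl y hs e => unseen k hk ((hs.prev_edge e).of_le hl)
  have inj : ∀ k l, k < l → l ≤ m → h k ≠ h l := by
    intro k l hkl hl e
    have hs := sees_own α i (show k + 1 ≤ m by omega)
    exact late k (by omega) k le_rfl i hs (e ▸ early l hl k hkl i hs (hne l hl).symm)
  have inj' : ∀ k l, k ≤ m → l ≤ m → h k = h l → k = l := by
    intro k l hk hl e
    rcases lt_trichotomy k l with h1 | h1 | h1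
    · exact (inj k l h1 hl e).elim
    · exact h1
    · exact (inj l k h1 hk e.symm).elim
  -- For `k < m`, `h k` crashes in round `k + 1` and reaches only its successor; `h m` is correct.
  -- Processes that crash in round `1` also reach `h 1`, which is invisible to `i` and lets `h 1`
  -- learn all inputs.
  let β : Adversary n :=
    { input := x
      crashTime := fun p => if p = h m then ⊤ else
        if H : ∃ k, k < m ∧ p = h k then (H.choose : ℕ∞) else α.crashTime p
      lastSent := fun p => if H : ∃ k, k < m ∧ p = h k then {h (H.choose + 1)} else
        if α.crashTime p = 0 then insert (h 1) (α.lastSent p) else α.lastSent p }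
  have hlast : β.Correct (h m) := if_pos rfl
  have hchain : ∀ k < m, β.crashTime (h k) = k ∧ β.lastSent (h k) = {h (k + 1)} := by
    intro k hk
    have H : ∃ l, l < m ∧ h k = h l := ⟨k, hk, rfl⟩
    have hc : H.choose = k := (inj' _ _ hk.le H.choose_spec.1.le H.choose_spec.2).symm
    constructor
    · change (if h k = h m then (⊤ : ℕ∞) else _) = _
      rw [if_neg (inj k m hk le_rfl), dif_pos H, hc]
    · change (if H : ∃ l, l < m ∧ h k = h l then ({h (H.choose + 1)} : Set (Fin n)) else _) = _
      rw [dif_pos H, hc]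
  have hother : ∀ p, (∀ k ≤ m, p ≠ h k) → β.crashTime p = α.crashTime p ∧
      β.lastSent p = if α.crashTime p = 0 then insert (h 1) (α.lastSent p) else α.lastSent p := by
    intro p hp
    have H : ¬ ∃ l, l < m ∧ p = h l := by
      rintro ⟨l, hl, e⟩
      exact hp l hl.le e
    constructor
    · change (if p = h m then (⊤ : ℕ∞) else _) = _
      rw [if_neg (hp m le_rfl), dif_neg H]
    · change (if H : ∃ l, l < m ∧ p = h l then ({h (H.choose + 1)} : Set (Fin n)) else _) = _
      rw [dif_neg H]
  have cases3 : ∀ p, p = h m ∨ (∃ k < m, p = h k) ∨ ∀ k ≤ m, p ≠ h k := by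
    intro p
    by_cases h1 : ∃ k ≤ m, p = h k
    · obtain ⟨k, hk, rfl⟩ := h1
      rcases hk.lt_or_eq with hk | rfl
      exacts [Or.inr (Or.inl ⟨k, hk, rfl⟩), Or.inl rfl]
    · push Not at h1
      exact Or.inr (Or.inr h1)
  have hedge : ∀ k < m, ∀ l y, β.Edge l (h k) y ↔ l < k ∨ (l = k ∧ y = h (k + 1)) := by
    intro k hk l y
    unfold Adversary.Edge
    rw [(hchain k hk).1, (hchain k hk).2]
    simp
  have hedge' : ∀ p, (∀ k ≤ m, p ≠ h k) → ∀ l y, (l = 0 → y ≠ h 1) →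
      (β.Edge l p y ↔ α.Edge l p y) := by
    intro p hp l y hy
    unfold Adversary.Edge
    rw [(hother p hp).1, (hother p hp).2]
    refine or_congr Iff.rfl (and_congr_right fun hl => ?_)
    split_ifs with h0
    · rw [h0] at hl
      rw [Set.mem_insert_iff, or_iff_right (hy (by exact_mod_cast hl))]
    · rfl
  refine ⟨β, h, rfl, hα.of_subset fun p hp => ?_, ?_, sameView_of_seen hx ?_,
    unseen 0 (Nat.zero_le m), hlast, hne, fun k hk => ⟨inj k _ (Nat.lt_succ_self k) hk,
      (hedge k hk k _).2 (Or.inr ⟨rfl, rfl⟩), fun e => ?_⟩, fun q hq => ?_⟩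
  -- The crash budget is respected: each `h k` with `k < m` already fails in `α`, because its
  -- message of round `k + 1` does not reach `i`.
  · rcases cases3 p with rfl | ⟨k, hk, rfl⟩ | h1
    · exact hlast
    · exact (late k hk.le k le_rfl i (sees_own α i hk) (hp.edge k i)).elim
    · exact (hother p h1).1.trans hp
  · unfold Adversary.Active
    rw [(hother i fun k hk => (hne k hk).symm).1]
    exact hi
  · intro l y hs p hp
    have hl : l < m := hs.le
    rcases cases3 p with rfl | ⟨k, hk, rfl⟩ | h1
    · exact iff_of_true (early m le_rfl l hl y hs hp.symm) (hlast.edge l y)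
    · rw [hedge k hk]
      rcases lt_or_ge l k with h1 | h1
      · exact iff_of_true (early k hk.le l h1 y hs hp.symm) (Or.inl h1)
      · refine iff_of_false (late k hk.le l h1 y hs) ?_
        rintro (h2 | ⟨rfl, rfl⟩)
        · omega
        · exact unseen (l + 1) hk hs
    · refine (hedge' p h1 l y ?_).symm
      rintro rfl rfl
      exact unseen 1 hm hs
  · rcases (hedge k hk k i).1 e with h1 | ⟨-, h1⟩
    · omega
    · exact hne (k + 1) hk h1.symm
  · rcases cases3 q with rfl | ⟨k, hk, rfl⟩ | h1
    · exact hlast.edge 0 _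
    · rw [hedge k hk]
      rcases Nat.eq_zero_or_pos k with rfl | h1
      exacts [Or.inr ⟨rfl, rfl⟩, Or.inl h1]
    · unfold Adversary.Edge
      rw [(hother q h1).1, (hother q h1).2]
      rcases eq_or_ne (α.crashTime q) 0 with h0 | h0
      · right
        rw [h0, if_pos rfl]
        exact ⟨rfl, Set.mem_insert _ _⟩
      · exact Or.inl (by simpa using pos_iff_ne_zero.2 h0)

end Hidden

/-! ### The protocol `Opt_Maj` -/

/-- The set `S` is a majority for the value `v`; ties count for `0`. -/
def IsMajority {n : ℕ} (v : Fin 2) (S : Set (Fin n)) : Prop :=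
  n + (v : ℕ) ≤ 2 * S.ncard

section OptMaj

variable {n t : ℕ} {Q : Protocol n} {α β : Adversary n} {i j : Fin n} {v w : Fin 2} {k m : ℕ}

theorem IsMajority.mono {S T : Set (Fin n)} (h : IsMajority v S) (hST : S ⊆ T) :
    IsMajority v T :=
  le_trans h (Nat.mul_le_mul_left 2 (Set.ncard_le_ncard hST (Set.toFinite _)))

theorem IsMajority.nonempty {S : Set (Fin n)} (i : Fin n) (h : IsMajority v S) : S.Nonempty := by
  rw [Set.nonempty_iff_ne_empty]
  rintro rfl
  unfold IsMajority at h
  have := i.pos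
  simp at h
  omega

theorem ncard_input_add (x : Fin n → Fin 2) (hvw : v ≠ w) :
    {q | x q = v}.ncard + {q | x q = w}.ncard = n := by
  have : {q | x q = w} = {q | x q = v}ᶜ := by
    ext q
    change x q = w ↔ ¬ x q = v
    omega
  rw [this, Set.ncard_add_ncard_compl, Nat.card_eq_fintype_card, Fintype.card_fin]

theorem isMajority_unique {x : Fin n → Fin 2} (hv : IsMajority v {q | x q = v})
    (hw : IsMajority w {q | x q = w}) : v = w := by
  by_contra h
  have := ncard_input_add x h
  unfold IsMajority at hv hw
  omega

theorem isMajority_of_not (x : Fin n → Fin 2) (hvw : v ≠ w) (h : ¬ IsMajority v {q | x q = v}) :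
    IsMajority w {q | x q = w} := by
  have := ncard_input_add x hvw
  unfold IsMajority at *
  omega

theorem seenWithInput_subset : seenWithInput α v m i ⊆ {q | α.input q = v} := fun _ h => h.2

theorem seenWithInput_edge (e : α.Edge m j i) :
    seenWithInput α v m j ⊆ seenWithInput α v (m + 1) i := fun _ h => ⟨h.1.edge e, h.2⟩

/-- The unseen inputs may all be opposite to `v`, so a known majority must consist of seen inputs.
-/
theorem knows_majority_iff (hα : α.InCrash t) (ha : α.Active i m) :
    Knows t (fun β _ => IsMajority v {q | β.input q = v}) (view α m i) ↔
      IsMajority v (seenWithInput α v m i) := by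
  classical
  rw [knows_iff]
  constructor
  · intro h
    obtain ⟨w, hw⟩ := exists_fin_two_ne v
    refine (h (α.withInput fun q => if Sees α 0 q m i then α.input q else w) hα ha
      (sameView_withInput fun q hq => (if_pos hq).symm)).mono fun q hq => ?_
    change (if Sees α 0 q m i then α.input q else w) = v at hq
    split_ifs at hq with hs
    · exact ⟨hs, hq⟩
    · exact (hw hq).elim
  · intro h β _ _ hs
    rw [hs.seenWithInput_eq] at h
    exact h.mono seenWithInput_subset

theorem knows_majZero_iff (hα : α.InCrash t) (ha : α.Active i m) :
    Knows t MajZero (view α m i) ↔ IsMajority 0 (seenWithInput α 0 m i) :=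
  knows_majority_iff (v := 0) hα ha

theorem knows_majOne_iff (hα : α.InCrash t) (ha : α.Active i m) :
    Knows t MajOne (view α m i) ↔ IsMajority 1 (seenWithInput α 1 m i) :=
  knows_majority_iff (v := 1) hα ha

theorem optMaj_exists_decidedBy (hα : α.InCrash t) (ha : α.Active i m)
    (h : (∃ v, IsMajority v (seenWithInput α v m i)) ∨ SomeTimeRevealed (view α m i)) :
    ∃ w, DecidedBy (optMaj n t) α i w m := by
  refine exists_decidedBy_fip ha ?_
  rw [knows_majZero_iff hα ha, knows_majOne_iff hα ha]
  split_ifs with h1 h2 h3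
  · simp
  · simp
  · simp
  · rcases h with ⟨v, hv⟩ | h
    · match v, hv with
      | 0, hv => exact (h1 hv).elim
      | 1, hv => exact (h2 hv).elim
    · exact (h3 h).elim

theorem optMaj_decidesAt (hα : α.InCrash t) (h : (optMaj n t).DecidesAt α i v m) :
    IsMajority v (seenWithInput α v m i) ∨ (SomeTimeRevealed (view α m i) ∧
      v = majVal t (view α m i) ∧ ∀ u, ¬ IsMajority u (seenWithInput α u m i)) := by
  have hr := rule_of_decidesAt_fip h
  rw [knows_majZero_iff hα h.1, knows_majOne_iff hα h.1] at hr
  split_ifs at hr with h1 h2 h3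
  · obtain rfl := Option.some.inj hr
    exact Or.inl h1
  · obtain rfl := Option.some.inj hr
    exact Or.inl h2
  · refine Or.inr ⟨h3, (Option.some.inj hr).symm, fun u hu => ?_⟩
    match u, hu with
    | 0, hu => exact h1 hu
    | 1, hu => exact h2 hu

theorem seenWithInput_subset_of_revealed (h : SomeTimeRevealed (view α m i)) (hj : α.Correct j)
    (k : ℕ) : seenWithInput α v k j ⊆ seenWithInput α v m i :=
  fun _ hq => ⟨h.seenInputs_subset hj k hq.1, hq.2⟩

open scoped Classical in
theorem majVal_view (hα : α.InCrash t) (ha : α.Active i m) : majVal t (view α m i) =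
    if (seenWithInput α 0 m i ∪ seenWithInput α 1 m i).ncard ≤ 2 * (seenWithInput α 0 m i).ncard
      then 0 else 1 := by
  unfold majVal
  rw [knownInputs_view hα ha, knownInputs_view hα ha]

/-- For agreement: a process to which a time is revealed has seen every input that a correct process
ever sees. It therefore also sees any majority that a correct process sees, and two correct
processes that decide by the last rule have seen the same inputs. -/
theorem optMaj_solves : Solves Consensus t (optMaj n t) := by
  intro α hα
  have dec : Decision (optMaj n t) α := by
    intro i hi
    obtain ⟨w, hw⟩ := optMaj_exists_decidedBy (m := t + 1) hα (hi.active _)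
      (Or.inr (someTimeRevealed_of_correct hα hi))
    exact ⟨w, hw.decides⟩
  refine ⟨dec, fun v hv i hi => ?_, ?_⟩
  · obtain ⟨w, m, hw⟩ := dec i hi
    suffices w = v from this ▸ ⟨m, hw⟩
    have hempty : ∀ u, u ≠ v → seenWithInput α u m i = ∅ := fun u hu =>
      Set.eq_empty_of_forall_notMem fun q hq => hu (hq.2.symm.trans (hv q))
    rcases optMaj_decidesAt hα hw with h | ⟨-, h, -⟩
    · obtain ⟨q, -, hq⟩ := h.nonempty i
      exact hq.symm.trans (hv q)
    · rw [majVal_view hα hw.1] at h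
      match v, hv, hempty with
      | 0, _, hempty =>
        rw [hempty 1 (by decide), Set.union_empty, if_pos (by omega)] at h
        exact h
      | 1, hv, hempty =>
        have hi1 : i ∈ seenWithInput α 1 m i := ⟨sees_own α i (Nat.zero_le m), hv i⟩
        have := (Set.ncard_pos (Set.toFinite _)).2 ⟨i, hi1⟩
        rw [hempty 0 (by decide), Set.empty_union, Set.ncard_empty, if_neg (by omega)] at h
        exact h
  · rintro i j v w hi hj ⟨m, hm⟩ ⟨m', hm'⟩
    rcases optMaj_decidesAt hα hm with h1 | ⟨h1, h2, h3⟩ <;>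
      rcases optMaj_decidesAt hα hm' with h1' | ⟨h1', h2', h3'⟩
    · exact isMajority_unique (h1.mono seenWithInput_subset) (h1'.mono seenWithInput_subset)
    · exact (h3' v (h1.mono (seenWithInput_subset_of_revealed h1' hi m))).elim
    · exact (h3 w (h1'.mono (seenWithInput_subset_of_revealed h1 hj m'))).elim
    · have e : ∀ u, seenWithInput α u m i = seenWithInput α u m' j := fun u =>
        (seenWithInput_subset_of_revealed h1' hi m).antisymm
          (seenWithInput_subset_of_revealed h1 hj m')
      rw [h2, h2', majVal_view hα hm.1, majVal_view hα hm'.1, e 0, e 1]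

theorem optMaj_spread (hα : α.InCrash t) (hj : α.Correct j) (h : DecidedBy (optMaj n t) α j v m)
    (hi : α.Active i (m + 1)) : ∃ w, DecidedBy (optMaj n t) α i w (m + 1) := by
  obtain ⟨k, hk, h⟩ := h
  have hk1 : k + 1 ≤ m + 1 := by omega
  obtain ⟨w, hw⟩ := optMaj_exists_decidedBy (m := k + 1) hα (hi.mono hk1) <| by
    rcases optMaj_decidesAt hα h with h | ⟨h, -⟩
    · exact Or.inl ⟨v, h.mono (seenWithInput_edge (hj.edge k i))⟩
    · exact Or.inr (h.edge (hj.edge k i))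
  exact ⟨w, hw.mono hk1⟩

/-! ### Majorities seen at times `0` and `1` -/

/-- The adversary without crashes. -/
def Adversary.noCrash {n : ℕ} (x : Fin n → Fin 2) : Adversary n := ⟨x, fun _ => ⊤, fun _ => ∅⟩

theorem Adversary.noCrash_correct (x : Fin n → Fin 2) (i : Fin n) : (noCrash x).Correct i := rfl

theorem Adversary.noCrash_inCrash (x : Fin n → Fin 2) : (noCrash x).InCrash t :=
  InCrash.of_set ∅ (by simp) fun _ _ => rfl

/-- The zero in the name is the time. A single input is then a majority, so with all inputs `v`
everybody sees one at time `0`. This is the tie-breaking case with two processes and `v = 0`, needed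
where no third process is available. -/
theorem decidedBy_zero_of_isMajority (hQ : Solves Consensus t Q)
    (hf : DecidesNoLater t Q (optMaj n t)) (hi : α.Active i 0)
    (h : IsMajority v (seenWithInput α v 0 i)) : DecidedBy Q α i v 0 := by
  have hseen : ∀ {β : Adversary n} {j q : Fin n}, q ∈ seenWithInput β v 0 j → q = j :=
    fun hq => (sees_zero.1 hq.1).1
  obtain ⟨q, hq⟩ := h.nonempty i
  obtain rfl := hseen hq
  have hβ : (Adversary.noCrash fun _ : Fin n => v).InCrash t := Adversary.noCrash_inCrash _
  have hone : ∀ j : Fin n, IsMajority v ({j} : Set (Fin n)) := fun j => by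
    have := h.mono (T := {q}) fun p hp => hseen hp
    unfold IsMajority at this ⊢
    rwa [Set.ncard_singleton] at this ⊢
  obtain ⟨w, hw⟩ := hf _ hβ 0 (fun j hj => optMaj_exists_decidedBy hβ hj
    (Or.inl ⟨v, (hone j).mono (Set.singleton_subset_iff.2 ⟨sees_self _ 0 j, rfl⟩)⟩)) q rfl
  obtain rfl := decides_unique hw.decides ((hQ _ hβ).2.1 v (fun _ => rfl) q rfl)
  exact hw.congr hq.2.symm hi

theorem sees_of_edge_zero {q : Fin n} (h : q = i ∨ α.Edge 0 q i) : Sees α 0 q 1 i := by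
  rcases h with rfl | h
  exacts [sees_own α q (Nat.zero_le 1), (sees_self α 0 q).edge h]

theorem sees_one_iff {q : Fin n} : Sees α 0 q 1 i ↔ q = i ∨ α.Edge 0 q i := by
  refine ⟨fun h => ?_, sees_of_edge_zero⟩
  rcases sees_succ.1 h with h | h | ⟨j, -, e, h⟩
  · omega
  · exact Or.inl (sees_zero.1 h).1
  · exact Or.inr ((sees_zero.1 h).1 ▸ e)

/-- Without crashes, all processes decide on the majority value by time `1`. -/
theorem noCrash_decidedBy (ht : 0 < t) (hQ : Solves Consensus t Q)
    (hf : DecidesNoLater t Q (optMaj n t)) (x : Fin n → Fin 2)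
    (hx : IsMajority v {q | x q = v}) (i : Fin n) : DecidedBy Q (.noCrash x) i v 1 := by
  have crash : ∀ (y : Fin n → Fin 2) (S : Set (Fin n)) (L : Fin n → Set (Fin n)),
      S.ncard ≤ t → IsMajority v {q | y q = v ∧ q ∉ S} →
      ((Adversary.noCrash y).extend 0 S L).InCrash t ∧ ∀ a, a ∉ S →
        ((Adversary.noCrash y).extend 0 S L).Correct a ∧
          ∃ u, DecidedBy Q ((Adversary.noCrash y).extend 0 S L) a u 1 := by
    intro y S L hS hy
    have hcor : ∀ a, a ∉ S → ((Adversary.noCrash y).extend 0 S L).Correct a := fun a ha =>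
      Adversary.extend_correct.2 ⟨(Adversary.noCrash_correct y a).active 0, ha⟩
    have hin := Adversary.InCrash.of_set S hS hcor
    refine ⟨hin, fun a ha => ⟨hcor a ha, ?_⟩⟩
    refine hf _ hin 1 (fun b hb => optMaj_exists_decidedBy hin hb (Or.inl ⟨v, ?_⟩)) a (hcor a ha)
    exact hy.mono fun q hq => ⟨sees_of_edge_zero (Or.inr ((hcor q hq.2).edge 0 b)), hq.1⟩
  have all : ∀ (y : Fin n → Fin 2) (a b : Fin n), IsMajority v {q | y q = v} →
      DecidedBy Q (.noCrash y) a v 1 → DecidedBy Q (.noCrash y) b v 1 := by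
    intro y a b hy ha
    have hin : (Adversary.noCrash y).InCrash t := Adversary.noCrash_inCrash y
    obtain ⟨u, hu⟩ := hf _ hin 1 (fun c hc => optMaj_exists_decidedBy hin hc
      (Or.inl ⟨v, hy.mono fun q hq => ⟨sees_of_edge_zero (Or.inr
        ((Adversary.noCrash_correct y q).edge 0 c)), hq⟩⟩)) b rfl
    obtain rfl := (hQ _ hin).2.2 b a u v rfl rfl hu.decides ha.decides
    exact hu
  -- Induction on the number of inputs that differ from `v`; the base case is validity.
  obtain ⟨c, hc⟩ : ∃ c, {q | x q ≠ v}.ncard = c := ⟨_, rfl⟩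
  induction c generalizing x with
  | zero =>
    rw [Set.ncard_eq_zero] at hc
    have hv : ∀ q, x q = v := fun q => by_contra fun h => (hc ▸ h : q ∈ (∅ : Set (Fin n)))
    have hin : (Adversary.noCrash x).InCrash t := Adversary.noCrash_inCrash x
    obtain ⟨u, hu⟩ := hf _ hin 1 (fun c hc => optMaj_exists_decidedBy hin hc
      (Or.inl ⟨v, hx.mono fun q hq => ⟨sees_of_edge_zero (Or.inr
        ((Adversary.noCrash_correct x q).edge 0 c)), hq⟩⟩)) i rfl
    obtain rfl := decides_unique hu.decides ((hQ _ hin).2.1 v hv i rfl)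
    exact hu
  | succ c ih =>
    obtain ⟨j, hj⟩ : ({q | x q ≠ v} : Set (Fin n)).Nonempty :=
      (Set.ncard_pos (Set.toFinite _)).1 (by omega)
    change x j ≠ v at hj
    obtain ⟨a, ha⟩ := hx.nonempty i
    change x a = v at ha
    have haj : a ≠ j := fun e => hj (e ▸ ha)
    by_cases h2 : ∃ b, b ≠ a ∧ b ≠ j
    swap
    · have hsub : ({q | x q = v} : Set (Fin n)) ⊆ seenWithInput (.noCrash x) v 0 a := by
        intro q hq
        change x q = v at hq
        obtain rfl : q = a := by
          by_contra h
          exact h2 ⟨q, h, fun e => hj (e ▸ hq)⟩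
        exact ⟨sees_self _ 0 q, hq⟩
      exact all x a i hx ((decidedBy_zero_of_isMajority hQ hf
        ((Adversary.noCrash_correct x a).active 0) (hx.mono hsub)).mono (Nat.zero_le 1))
    obtain ⟨b, hba, hbj⟩ := h2
    have hx' : ∀ y : Fin n → Fin 2, (∀ q, q ≠ j → y q = x q) →
        IsMajority v {q | y q = v ∧ q ∉ ({j} : Set (Fin n))} := fun y hy =>
      hx.mono fun q hq => by
        have : q ≠ j := fun e => hj (e ▸ hq)
        exact ⟨(hy q this).trans hq, this⟩
    set x' := Function.update x j v with hx'def
    have hxx' : ∀ q, q ≠ j → x' q = x q := fun q hq => Function.update_of_ne hq _ _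
    have ih' : DecidedBy Q (.noCrash x') a v 1 := by
      have hmaj := (hx' x' hxx').mono (show _ ⊆ {q | x' q = v} from fun q hq => hq.1)
      refine all x' i a hmaj (ih x' hmaj ?_)
      have : ({q | x' q ≠ v} : Set (Fin n)) = {q | x q ≠ v} \ {j} := by
        ext q
        change x' q ≠ v ↔ x q ≠ v ∧ ¬ q = j
        by_cases hq : q = j
        · subst hq; simp [hx'def]
        · simp [hq, hxx' q hq]
      rw [this, Set.ncard_sdiff_singleton_of_mem (show j ∈ {q | x q ≠ v} from hj), hc]
      omega
    have hS : ({j} : Set (Fin n)).ncard ≤ t := by rw [Set.ncard_singleton]; omega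
    -- The process `j` whose input is flipped crashes in round `1` and reaches only `a`. Then `a`
    -- does not notice the crash and `b` does not notice the flip, while everybody still sees a
    -- majority for `v`. The decision travels from `a` to `b` before the flip is undone, and back to
    -- `a` afterwards.
    let ρ : (Fin n → Fin 2) → Adversary n := fun y =>
      (Adversary.noCrash y).extend 0 {j} fun _ => {a}
    have hρ := fun y hy => crash y {j} (fun _ => {a}) hS (hx' y hy)
    have sameA : ∀ y, SameView (.noCrash y) (ρ y) 1 a := fun y => by
      refine ⟨rfl, fun q hq => ⟨iff_of_true ((Adversary.noCrash_correct y q).edge 0 a)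
        (Adversary.extend_edge_self.2 ⟨(Adversary.noCrash_correct y q).active 0, fun _ => rfl⟩),
        fun _ => rfl⟩⟩
    have sameB : SameView (ρ x') (ρ x) 1 b := by
      refine ⟨hxx' b hbj, fun q hq => ⟨Iff.rfl, fun e => hxx' q ?_⟩⟩
      rintro rfl
      exact hba ((Adversary.extend_edge_self.1 e).2 rfl)
    obtain ⟨hin', hdec'⟩ := hρ x' hxx'
    obtain ⟨hin, hdec⟩ := hρ x fun _ _ => rfl
    obtain ⟨u, hu⟩ := (hdec' b hbj).2
    obtain rfl := (hQ _ hin').2.2 b a u v (hdec' b hbj).1 (hdec' a haj).1 hu.decides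
      (ih'.congr (sameA x') ((hdec' a haj).1.active 1)).decides
    obtain ⟨w, hw⟩ := (hdec a haj).2
    obtain rfl := (hQ _ hin).2.2 a b w u (hdec a haj).1 (hdec b hbj).1 hw.decides
      (hu.congr sameB ((hdec b hbj).1.active 1)).decides
    exact all x a i hx (hw.congr (sameA x).symm ((Adversary.noCrash_correct x a).active 1))

/-- The one in the name is the time. If all seen inputs are `v`, validity suffices. Otherwise `i`
has an informer `a`, and the value comes from the crash-free run. -/
theorem decidedBy_one_of_isMajority (ht : 0 < t) (hQ : Solves Consensus t Q)
    (hf : DecidesNoLater t Q (optMaj n t)) (hα : α.InCrash t) (hi : α.Active i 1)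
    (h : IsMajority v (seenWithInput α v 1 i)) : DecidedBy Q α i v 1 := by
  have informed : ∀ (L : Fin n → Set (Fin n)) (x : Fin n → Fin 2),
      (∀ q ∈ seenInputs α 1 i, α.input q = x q) →
      (((α.confirm 0 i L).withInput x).InCrash t) ∧ ((α.confirm 0 i L).withInput x).Correct i ∧
      SameView α ((α.confirm 0 i L).withInput x) 1 i ∧
      ∀ a, ((α.confirm 0 i L).withInput x).Correct a →
        ∃ u, DecidedBy Q ((α.confirm 0 i L).withInput x) a u 1 := by
    intro L x hx
    have hs : SameView α (α.confirm 0 i L) 1 i := Adversary.confirm_sameView_succ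
    have hc : ∀ q, q = i ∨ α.Edge 0 q i → (α.confirm 0 i L).Correct q := by
      rintro q (rfl | e)
      exacts [Adversary.confirm_correct_self (hi.mono (Nat.zero_le 1)),
        Adversary.confirm_correct e]
    have hin : ((α.confirm 0 i L).withInput x).InCrash t :=
      show (α.confirm 0 i L).InCrash t from Adversary.confirm_inCrash hα
    refine ⟨hin, hc i (Or.inl rfl), hs.trans (sameView_withInput fun q hq => hx q (hs.symm.sees hq)),
      hf _ hin 1 fun b hb => optMaj_exists_decidedBy hin hb (Or.inl ⟨v, h.mono fun q hq => ⟨?_, ?_⟩⟩)⟩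
    · exact sees_of_edge_zero (Or.inr ((hc q (sees_one_iff.1 hq.1)).edge 0 b))
    · exact (hx q hq.1).symm.trans hq.2
  by_cases hall : ∀ q ∈ seenInputs α 1 i, α.input q = v
  · obtain ⟨hin, hci, hs, hd⟩ := informed (fun _ => ∅) (fun _ => v) hall
    obtain ⟨u, hu⟩ := hd i hci
    obtain rfl := decides_unique hu.decides ((hQ _ hin).2.1 v (fun _ => rfl) i hci)
    exact hu.congr hs.symm hi
  · push Not at hall
    obtain ⟨s, hs, hsv⟩ := hall
    obtain ⟨z, hz, hzv⟩ := h.nonempty i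
    obtain ⟨a, hai, ha⟩ : ∃ a, a ≠ i ∧ α.Edge 0 a i := by
      rcases sees_one_iff.1 hs with rfl | e
      · have hzs : z ≠ s := fun e => hsv (e ▸ hzv)
        exact ⟨z, hzs, (sees_one_iff.1 hz).resolve_left hzs⟩
      · by_cases hsi : s = i
        · have hzi : z ≠ i := fun e => hsv (hsi.trans e.symm ▸ hzv)
          exact ⟨z, hzi, (sees_one_iff.1 hz).resolve_left hzi⟩
        · exact ⟨s, hsi, e⟩
    obtain ⟨hin, hci, hsame, hd⟩ := informed (fun _ => Set.univ) α.input fun _ _ => rfl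
    -- The processes that do not inform `i` reach everybody else, so `a` cannot tell this run from
    -- the crash-free one.
    set β := (α.confirm 0 i fun _ => Set.univ).withInput α.input with hβ
    have hca : β.Correct a :=
      show (α.confirm 0 i fun _ => Set.univ).Correct a from Adversary.confirm_correct ha
    have sameA : SameView (.noCrash α.input) β 1 a := by
      refine ⟨rfl, fun q hq => ⟨iff_of_true ((Adversary.noCrash_correct _ q).edge 0 a) ?_,
        fun _ => rfl⟩⟩
      exact Adversary.extend_edge_self.2 ⟨bot_le, fun _ => ⟨Set.mem_univ a, hai⟩⟩
    have hda : DecidedBy Q β a v 1 := (noCrash_decidedBy ht hQ hf α.input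
      (h.mono seenWithInput_subset) a).congr sameA (hca.active 1)
    obtain ⟨u, hu⟩ := hd i hci
    obtain rfl := (hQ _ hin).2.2 i a u v hci hca hu.decides hda.decides
    exact hu.congr hsame.symm hi

/-- If everyone not informing `i` is silent, then `j` is correct and shows its majority to all. So
`Opt_Maj` is finished and `i` must agree with `j`. -/
theorem DecidedBy.isMajority_edge (hQ : Solves Consensus t Q)
    (hf : DecidesNoLater t Q (optMaj n t)) (hα : α.InCrash t) (hi : α.Active i (m + 1))
    (e : α.Edge m j i) (hm : IsMajority v (seenWithInput α v m j)) (h : DecidedBy Q α j v m) :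
    DecidedBy Q α i v (m + 1) := by
  set β := α.confirm m i fun _ => ∅ with hβdef
  have hβ : β.InCrash t := Adversary.confirm_inCrash hα
  have hiβ : β.Correct i := Adversary.confirm_correct_self (hi.mono (Nat.le_succ m))
  have hjβ : β.Correct j := Adversary.confirm_correct e
  have hs : SameView α β m j := Adversary.confirm_sameView le_rfl
  rw [hs.seenWithInput_eq] at hm
  obtain ⟨w, hw⟩ := hf β hβ (m + 1) (fun p hp => optMaj_exists_decidedBy hβ hp
    (Or.inl ⟨v, hm.mono (seenWithInput_edge (hjβ.edge m p))⟩)) i hiβ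
  obtain rfl := (hQ β hβ).2.2 i j w v hiβ hjβ hw.decides (h.congr hs (hjβ.active m)).decides
  exact hw.congr Adversary.confirm_sameView_succ.symm hi

theorem optMaj_decided (ht : 0 < t) (hQ : Solves Consensus t Q)
    (hf : DecidesNoLater t Q (optMaj n t)) (hα : α.InCrash t) (hi : α.Active i m)
    (h : DecidedBy Q α i v m) : ∃ w, DecidedBy (optMaj n t) α i w m := by
  classical
  refine optMaj_exists_decidedBy hα hi ?_
  by_contra hc
  push Not at hc
  obtain ⟨hmaj, hrev⟩ := hc
  obtain ⟨w, hw⟩ := exists_fin_two_ne v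
  -- As `i` sees no majority for `v`, giving all unseen inputs the other value `w` makes `w` the
  -- majority.
  let x : Fin n → Fin 2 := fun q => if Sees α 0 q m i then α.input q else w
  have hx : ∀ q ∈ seenInputs α m i, α.input q = x q := fun q hq => (if_pos hq).symm
  have hxw : IsMajority w {q | x q = w} := by
    refine isMajority_of_not x hw.symm fun h' => hmaj v (h'.mono fun q hq => ?_)
    change (if Sees α 0 q m i then α.input q else w) = v at hq
    split_ifs at hq with hs
    exacts [⟨hs, hq⟩, (hw hq).elim]
  rcases Nat.eq_zero_or_pos m with rfl | hm
  · have h1 := noCrash_decidedBy ht hQ hf x hxw i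
    have h2 : DecidedBy Q (.noCrash x) i v 0 := h.congr (hx i (sees_self α 0 i))
      ((Adversary.noCrash_correct x i).active 0)
    exact hw (decides_unique h1.decides h2.decides)
  obtain ⟨β, c, hin, hβ, hiβ, hs, -, hcm, hci, hc, hone⟩ := exists_hidden_chain hα hi hm hrev x hx
  have hact : ∀ k ≤ m, β.Active (c k) k := by
    intro k hk
    rcases hk.lt_or_eq with hk | rfl
    exacts [(hc k hk).2.1.active, hcm.active k]
  have chain : ∀ k, k + 1 ≤ m → IsMajority w (seenWithInput β w (k + 1) (c (k + 1))) ∧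
      DecidedBy Q β (c (k + 1)) w (k + 1) := by
    intro k hk
    induction k with
    | zero =>
      have hm1 : IsMajority w (seenWithInput β w 1 (c 1)) := hxw.mono fun q hq => by
        refine ⟨sees_of_edge_zero ?_, (congrFun hin q).trans hq⟩
        exact (eq_or_ne q (c 1)).imp_right (hone q)
      exact ⟨hm1, decidedBy_one_of_isMajority ht hQ hf hβ (hact 1 hk) hm1⟩
    | succ k ih =>
      obtain ⟨h1, h2⟩ := ih (by omega)
      have e := (hc (k + 1) hk).2.1
      exact ⟨h1.mono (seenWithInput_edge e),
        h2.isMajority_edge hQ hf hβ (hact _ hk) e h1⟩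
  obtain ⟨k, rfl⟩ : ∃ k, m = k + 1 := ⟨m - 1, by omega⟩
  have hcw := (chain k le_rfl).2
  set γ := β.extend (k + 1) ∅ fun _ => ∅ with hγdef
  have hγ : γ.InCrash t := hβ.extend_empty
  have same : ∀ p, SameView β γ (k + 1) p := fun p => Adversary.extend_sameView le_rfl
  have hiγ : γ.Correct i := Adversary.extend_correct.2 ⟨hiβ, Set.notMem_empty i⟩
  have hcγ : γ.Correct (c (k + 1)) :=
    Adversary.extend_correct.2 ⟨hcm.active _, Set.notMem_empty _⟩
  exact hw ((hQ γ hγ).2.2 _ i w v hcγ hiγ (hcw.congr (same _) (hcγ.active _)).decides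
    (h.congr (hs.trans (same i)) (hiγ.active _)).decides)

theorem optMaj_ldUnbeatable {who : Adversary n → Fin n → Prop} (ht : t < n) (ht0 : 0 < t)
    (hwho : ∀ α i, α.Correct i → who α i) : LDUnbeatable who Consensus t (optMaj n t) :=
  ldUnbeatable_of ht hwho (fun _ _ h => h.1) optMaj_solves
    (fun _ hQ hf _ hα _ _ m hi h => optMaj_decided ht0 hQ hf hα (hi.active m) h)
    fun _ hα _ _ _ hp h _ hi => optMaj_spread hα hp h hi

end OptMaj

/-! ### The protocol `u-Opt₀` -/

section UOptZero

variable {n t : ℕ} {Q : Protocol n} {α β : Adversary n} {i j p x : Fin n} {v w : Fin 2}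
  {k l m : ℕ}

theorem Adversary.extend_silent_edge {C : Set (Fin n)} (hk : m ≤ k) :
    (α.extend m C fun _ => ∅).Edge k p j ↔ α.Active p m ∧ p ∉ C := by
  rcases hk.eq_or_lt with rfl | hk
  · rw [extend_edge_self]
    rfl
  · exact extend_edge_of_gt hk

theorem existsCorrect_iff (hα : α.InCrash t) :
    ExistsCorrect t v α m ↔ ∃ j, α.Correct j ∧ SeesValue α v m j :=
  exists_congr fun _ => and_congr_right fun hj => knows_existsInput_iff hα (hj.active m)

theorem ExistsCorrect.mono (hα : α.InCrash t) (h : ExistsCorrect t v α k) (hk : k ≤ m) :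
    ExistsCorrect t v α m := by
  rw [existsCorrect_iff hα] at *
  exact h.imp fun j hj => ⟨hj.1, hj.2.mono hk⟩

/-- A process still active after the round has delivered its message to everybody, in particular to
a correct process. -/
theorem knows_existsCorrect_of_seesValue (ht : t < n) (h : SeesValue α v m i) :
    Knows t (ExistsCorrect t v) (view α (m + 1) i) := by
  rw [knows_iff]
  intro β hβ hi hs
  obtain ⟨p, hp⟩ := Adversary.exists_correct ht hβ
  exact (existsCorrect_iff hβ).2 ⟨p, hp,
    (hs.1.seesValue h).edge (Adversary.edge_of_active_succ hi p)⟩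

/-- A process that misses at least `t - 1` others knows that the value is known to a correct
process as soon as a second process has seen it. -/
theorem knows_existsCorrect_of_missing (ht : t < n) (hx : SeesValue α v m x)
    (e : x = p ∨ α.Edge m x p) (hmiss : t ≤ (α.Missing m p).ncard + 1) :
    Knows t (ExistsCorrect t v) (view α (m + 1) p) := by
  by_cases hxp : x = p
  · exact knows_existsCorrect_of_seesValue ht (hxp ▸ hx)
  replace e := e.resolve_left hxp
  rw [knows_iff]
  intro β hβ hp hs
  rw [existsCorrect_iff hβ]
  have eβ : β.Edge m x p := (hs.2 x hxp).1.1 e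
  have hxβ : SeesValue β v m x := ((hs.2 x hxp).2 e).seesValue hx
  by_contra hc
  push Not at hc
  have hpc : ¬ β.Correct p := fun h => hc p h (hxβ.edge eβ)
  have hxc : ¬ β.Correct x := fun h => hc x h (hxβ.mono (Nat.le_succ m))
  have h1 : p ∉ α.Missing m p := fun h => h.1 rfl
  have h2 : x ∉ insert p (α.Missing m p) := by
    rintro (h | h)
    exacts [hxp h, h.2 e]
  have := hβ.ncard_le (S := insert x (insert p (α.Missing m p))) (by
    rintro q (rfl | rfl | hq)
    · exact hxc
    · exact hpc
    · exact Adversary.not_correct_of_not_edge (mt (hs.2 q hq.1).1.2 hq.2))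
  rw [Set.ncard_insert_of_notMem h2, Set.ncard_insert_of_notMem h1] at this
  omega

theorem uOpt0_exists_decidedBy (hα : α.InCrash t) (ha : α.Active i m)
    (h : Knows t (ExistsCorrect t 0) (view α m i) ∨
      (¬ SeesValue α 0 m i ∧ SomeTimeRevealed (view α m i))) :
    ∃ w, DecidedBy (uOpt0 n t) α i w m :=
  exists_decidedBy_fip ha (zeroOneRule_ne_none
    (h.imp_right (And.imp_left (mt (knows_existsInput_iff hα ha).1))))

theorem uOpt0_decidesAt_zero (h : (uOpt0 n t).DecidesAt α i 0 m) :
    Knows t (ExistsCorrect t 0) (view α m i) :=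
  zeroOneRule_eq_zero (rule_of_decidesAt_fip h)

theorem uOpt0_decidesAt_one (hα : α.InCrash t) (h : (uOpt0 n t).DecidesAt α i 1 m) :
    ¬ SeesValue α 0 m i ∧ SomeTimeRevealed (view α m i) :=
  (zeroOneRule_eq_one (rule_of_decidesAt_fip h)).2.imp_left
    (mt (knows_existsInput_iff hα h.1).2)

/-- Uniform agreement holds because a decision on `0` guarantees a correct process that has seen a
`0`, and a process to which a time is revealed has seen all that correct processes ever see. -/
theorem uOpt0_solves (ht : t < n) : Solves UniformConsensus t (uOpt0 n t) := by
  intro α hα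
  have dec : Decision (uOpt0 n t) α := by
    intro i hi
    by_cases hs : SeesValue α 0 (t + 1) i
    · obtain ⟨w, hw⟩ := uOpt0_exists_decidedBy (m := t + 2) hα (hi.active _)
        (Or.inl (knows_existsCorrect_of_seesValue ht hs))
      exact ⟨w, hw.decides⟩
    · obtain ⟨w, hw⟩ := uOpt0_exists_decidedBy (m := t + 1) hα (hi.active _)
        (Or.inr ⟨hs, someTimeRevealed_of_correct hα hi⟩)
      exact ⟨w, hw.decides⟩
  have agree : ∀ i j, (uOpt0 n t).Decides α i 0 → ¬ (uOpt0 n t).Decides α j 1 := by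
    rintro i j ⟨m, hm⟩ ⟨m', hm'⟩
    obtain ⟨p, hp, hs⟩ := (existsCorrect_iff hα).1 ((uOpt0_decidesAt_zero hm).holds hα hm.1)
    obtain ⟨h1, h2⟩ := uOpt0_decidesAt_one hα hm'
    exact h1 (h2.seesValue hp hs)
  refine ⟨dec, fun v hv i hi => ?_, fun i j v w h1 h2 => ?_⟩
  · obtain ⟨w, m, hw⟩ := dec i hi
    match w, hw with
    | 0, hw =>
      obtain ⟨p, -, q, -, hq⟩ :=
        (existsCorrect_iff hα).1 ((uOpt0_decidesAt_zero hw).holds hα hw.1)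
      exact (hv q).symm.trans hq ▸ ⟨m, hw⟩
    | 1, hw =>
      have h1 : v ≠ 0 := fun e => (uOpt0_decidesAt_one hα hw).1
        ⟨i, sees_own α i (Nat.zero_le m), (hv i).trans e⟩
      obtain rfl : v = 1 := by omega
      exact ⟨m, hw⟩
  · match v, w, h1, h2 with
    | 0, 0, _, _ => rfl
    | 1, 1, _, _ => rfl
    | 0, 1, h1, h2 => exact (agree i j h1 h2).elim
    | 1, 0, h1, h2 => exact (agree j i h2 h1).elim

theorem uOpt0_spread (hα : α.InCrash t) (hj : α.Correct j) (h : DecidedBy (uOpt0 n t) α j v m)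
    (hi : α.Active i (m + 1)) : ∃ w, DecidedBy (uOpt0 n t) α i w (m + 1) := by
  obtain ⟨k, hk, h⟩ := h
  have hk1 : k + 1 ≤ m + 1 := by omega
  obtain ⟨w, hw⟩ := uOpt0_exists_decidedBy (m := k + 1) hα (hi.mono hk1) <| by
    match v, h with
    | 0, h => exact Or.inl ((uOpt0_decidesAt_zero h).edge
        (fun β hβ hk => hk.mono hβ (Nat.le_succ k)) (hj.edge k i))
    | 1, h =>
      obtain ⟨h1, h2⟩ := uOpt0_decidesAt_one hα h
      exact Or.inr ⟨fun hs => h1 (h2.seesValue_of_le (hi.mono hk1) (Nat.le_succ k) hs),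
        h2.edge (hj.edge k i)⟩
  exact ⟨w, hw.mono hk1⟩

/-! ### Rounds with few survivors -/

/-- After time `k` only `x` and the processes in `B` survive; in the next round `x` also hears from
the processes in `R`, and nobody else hears from a process that crashes. -/
noncomputable def Adversary.survive {n : ℕ} (α : Adversary n) (k : ℕ) (x : Fin n)
    (B R : Set (Fin n)) : Adversary n :=
  α.extend k (insert x B)ᶜ fun q => {p | p = x ∧ q ∈ R}

variable {B R R' : Set (Fin n)}

theorem Adversary.survive_correct :
    (α.survive k x B R).Correct p ↔ α.Active p k ∧ p ∈ insert x B := by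
  unfold survive
  rw [extend_correct, Set.notMem_compl_iff]

theorem Adversary.survive_edge_self (hB : B ⊆ R) (hp : p ≠ x) :
    (α.survive k x B R).Edge k p x ↔ α.Active p k ∧ p ∈ R := by
  unfold survive
  rw [extend_edge_self]
  refine and_congr_right fun _ => ⟨fun h => ?_, fun h _ => ⟨rfl, h⟩⟩
  by_cases hpB : p ∈ B
  · exact hB hpB
  · refine (h ?_).2
    rintro (h | h)
    exacts [hp h, hpB h]

theorem Adversary.survive_edge_of_ne (hj : j ≠ x) :
    (α.survive k x B R).Edge k p j ↔ α.Active p k ∧ p ∈ insert x B := by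
  unfold survive
  rw [extend_edge_self]
  refine and_congr_right fun _ => ⟨fun h => ?_, fun h h' => (h' h).elim⟩
  by_contra hp
  exact hj (h hp).1

theorem ncard_compl_insert (hx : x ∉ B) : ((insert x B)ᶜ).ncard = n - (B.ncard + 1) := by
  rw [Set.ncard_compl, Set.ncard_insert_of_notMem hx, Nat.card_eq_fintype_card, Fintype.card_fin]

theorem Adversary.survive_inCrash (hx : x ∉ B) (hB : n ≤ t + B.ncard + 1)
    (ha : ∀ p ∈ insert x B, α.Active p k) : (α.survive k x B R).InCrash t :=
  InCrash.of_set (insert x B)ᶜ (by rw [ncard_compl_insert hx]; omega)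
    fun p hp => survive_correct.2 ⟨ha p (Set.notMem_compl_iff.1 hp), Set.notMem_compl_iff.1 hp⟩

/-- With few survivors, `u-Opt₀` decides at once, and so do solutions that are not slower. -/
theorem survive_decidedBy (ht : t < n) (hf : DecidesNoLater t Q (uOpt0 n t)) (hx : x ∉ B)
    (hB : n ≤ t + B.ncard + 1) (hB' : t + B.ncard ≤ n) (ha : ∀ p ∈ insert x B, α.Active p k)
    (hs : SeesValue α 0 k x) (hp : p ∈ insert x B) :
    ∃ u, DecidedBy Q (α.survive k x B R) p u (k + 1) := by
  have hin : (α.survive k x B R).InCrash t := Adversary.survive_inCrash hx hB ha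
  have hs' : SeesValue (α.survive k x B R) 0 k x := (Adversary.extend_sameView le_rfl).seesValue hs
  have hxc : (α.survive k x B R).Correct x :=
    Adversary.survive_correct.2 ⟨ha x (Set.mem_insert x B), Set.mem_insert x B⟩
  refine hf _ hin (k + 1) (fun q hq => uOpt0_exists_decidedBy hin hq (Or.inl ?_)) p
    (Adversary.survive_correct.2 ⟨ha p hp, hp⟩)
  by_cases hqx : q = x
  · exact knows_existsCorrect_of_seesValue ht (hqx ▸ hs')
  -- The bounds on `B.ncard` say that `t` or `t - 1` processes lie outside the survivors. The run is
  -- thus admissible, and yet every survivor other than `x` misses enough messages to conclude.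
  refine knows_existsCorrect_of_missing ht hs' (Or.inr (hxc.edge k q)) ?_
  have hqB : q ∈ insert x B :=
    Set.notMem_compl_iff.1 ((Adversary.extend_active_of_lt (Nat.lt_succ_self k)).1 hq).2
  have : ((insert x B)ᶜ).ncard ≤ ((α.survive k x B R).Missing k q).ncard := by
    refine Set.ncard_le_ncard (fun r hr => ⟨?_, ?_⟩) (Set.toFinite _)
    · rintro rfl
      exact hr hqB
    · rw [Adversary.survive_edge_of_ne hqx]
      exact fun h => hr h.2
  rw [ncard_compl_insert hx] at this
  omega

/-- `x` hears from the active processes in `R` whether they survive or not, so the set of survivors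
can be changed behind its back. -/
theorem survive_sameView (hB : B ⊆ R) {B' : Set (Fin n)} (hB' : B' ⊆ R) :
    SameView (α.survive k x B R) (α.survive k x B' R) (k + 1) x := by
  have hs : ∀ p, SameView (α.survive k x B R) (α.survive k x B' R) k p := fun p =>
    (Adversary.extend_sameView le_rfl).symm.trans (Adversary.extend_sameView le_rfl)
  exact ⟨hs x, fun q hq => ⟨by rw [Adversary.survive_edge_self hB hq,
    Adversary.survive_edge_self hB' hq], fun _ => hs q⟩⟩

/-- The decision of `x` in a round with few survivors depends only on the views of the
survivors. -/
theorem survive_link (ht : t < n) (hQ : Solves UniformConsensus t Q)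
    (hf : DecidesNoLater t Q (uOpt0 n t)) (hx : x ∉ B) (hne : B.Nonempty)
    (hB : n ≤ t + B.ncard + 1) (hB' : t + B.ncard ≤ n)
    (ha : ∀ p ∈ insert x B, α.Active p k) (hb : ∀ p ∈ insert x B, β.Active p k)
    (hsame : ∀ p ∈ insert x B, SameView α β k p) (hs : SeesValue α 0 k x)
    (h : DecidedBy Q (α.survive k x B R) x v (k + 1)) :
    DecidedBy Q (β.survive k x B R') x v (k + 1) := by
  obtain ⟨b, hbB⟩ := hne
  have hbx : b ≠ x := fun e => hx (e ▸ hbB)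
  have hbm : b ∈ insert x B := Set.mem_insert_of_mem x hbB
  have hxm : x ∈ insert x B := Set.mem_insert x B
  -- A survivor `b` other than `x` hears from survivors only, so the two runs look alike to it.
  -- Agreement between `b` and `x` within each run transports the decision of `x`.
  have view : SameView (α.survive k x B R) (β.survive k x B R') (k + 1) b := by
    have hs : ∀ p ∈ insert x B, SameView (α.survive k x B R) (β.survive k x B R') k p :=
      fun p hp => (Adversary.extend_sameView le_rfl).symm.trans
        ((hsame p hp).trans (Adversary.extend_sameView le_rfl))
    refine ⟨hs b hbm, fun q _ => ⟨?_, fun e => ?_⟩⟩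
    · rw [Adversary.survive_edge_of_ne hbx, Adversary.survive_edge_of_ne hbx]
      exact and_congr_left fun hq => iff_of_true (ha q hq) (hb q hq)
    · rw [Adversary.survive_edge_of_ne hbx] at e
      exact hs q e.2
  have hinA : (α.survive k x B R).InCrash t := Adversary.survive_inCrash hx hB ha
  have hinB : (β.survive k x B R').InCrash t := Adversary.survive_inCrash hx hB hb
  obtain ⟨u, hu⟩ := survive_decidedBy (R := R) ht hf hx hB hB' ha hs hbm
  obtain rfl := (hQ _ hinA).2.2 b x u v hu.decides h.decides
  obtain ⟨w, hw⟩ := survive_decidedBy (R := R') ht hf hx hB hB' hb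
    ((hsame x hxm).seesValue hs) hxm
  have hbB := hu.congr view ((Adversary.survive_correct.2 ⟨hb b hbm, hbm⟩).active (k + 1))
  obtain rfl := (hQ _ hinB).2.2 x b w u hw.decides hbB.decides
  exact hw

/-- The views of the processes in `R` may be replaced one by one without changing the decision
of `x`, which hears from all of them. -/
theorem survive_replace (ht : t < n) (hQ : Solves UniformConsensus t Q)
    (hf : DecidesNoLater t Q (uOpt0 n t)) (hx : x ∉ R) (h2 : 2 ≤ R.ncard)
    (hR : n ≤ t + R.ncard) (hR' : t + R.ncard ≤ n + 1) (F : Set (Fin n) → Adversary n)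
    (hact : ∀ W ⊆ R, ∀ p ∈ insert x R, (F W).Active p k)
    (hF : ∀ W ⊆ R, ∀ z ∈ R, ∀ p ∈ insert x R, p ≠ z → SameView (F W) (F (insert z W)) k p)
    (hs : SeesValue (F ∅) 0 k x)
    (h : ∃ B ⊆ R, DecidedBy Q ((F R).survive k x B R) x v (k + 1)) :
    ∀ B ⊆ R, DecidedBy Q ((F ∅).survive k x B R) x v (k + 1) := by
  have hactive : ∀ W ⊆ R, ∀ B ⊆ R, ((F W).survive k x B R).Active x (k + 1) := fun W hW B _ =>
    (Adversary.survive_correct.2 ⟨hact W hW x (Set.mem_insert x R),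
      Set.mem_insert x B⟩).active _
  have indep : ∀ W ⊆ R, (∃ B ⊆ R, DecidedBy Q ((F W).survive k x B R) x v (k + 1)) →
      ∀ B ⊆ R, DecidedBy Q ((F W).survive k x B R) x v (k + 1) := by
    rintro W hW ⟨B, hB, h⟩ B' hB'
    exact h.congr (survive_sameView hB hB') (hactive W hW B' hB')
  have hsees : ∀ W ⊆ R, SeesValue (F W) 0 k x := by
    intro W
    have hfin := Set.toFinite W
    induction W, hfin using Set.Finite.induction_on with
    | empty => exact fun _ => hs
    | @insert z W _ _ ih =>
      intro hW
      have hz : z ∈ R := hW (Set.mem_insert z W)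
      have hW' : W ⊆ R := (Set.subset_insert z W).trans hW
      exact (hF W hW' z hz x (Set.mem_insert x R) fun e => hx (e ▸ hz)).seesValue (ih hW')
  suffices H : ∀ W, W ⊆ R → (∃ B ⊆ R, DecidedBy Q ((F W).survive k x B R) x v (k + 1)) →
      ∀ B ⊆ R, DecidedBy Q ((F ∅).survive k x B R) x v (k + 1) from H R subset_rfl h
  intro W
  have hfin := Set.toFinite W
  induction W, hfin using Set.Finite.induction_on with
  | empty => exact fun hW => indep ∅ hW
  | @insert z W _ _ ih =>
    intro hW h
    have hz : z ∈ R := hW (Set.mem_insert z W)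
    have hW' : W ⊆ R := (Set.subset_insert z W).trans hW
    have hsub : R \ {z} ⊆ R := Set.sdiff_subset
    have hsub' : insert x (R \ {z}) ⊆ insert x R := Set.insert_subset_insert hsub
    have hcard : (R \ {z}).ncard + 1 = R.ncard :=
      Set.ncard_sdiff_singleton_add_one hz (Set.toFinite R)
    have hpz : ∀ p ∈ insert x (R \ {z}), p ≠ z := by
      rintro p (rfl | hp) rfl
      exacts [hx hz, hp.2 rfl]
    -- Only the view of `z` changes, so `z` is made to crash. `x` still hears from it, but the
    -- survivors that fix the decision do not.
    refine ih hW' ⟨R \ {z}, hsub, survive_link ht hQ hf (fun h => hx h.1)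
      ((Set.ncard_pos (Set.toFinite _)).1 (by omega)) (by omega) (by omega)
      (fun p hp => hact _ hW p (hsub' hp)) (fun p hp => hact _ hW' p (hsub' hp))
      (fun p hp => (hF W hW' z hz p (hsub' hp) (hpz p hp)).symm) (hsees _ hW)
      (indep _ hW h _ hsub)⟩

/-- The decision of `x` may be computed in a run with few survivors. -/
theorem decidedBy_of_survive (ht : t < n) (hQ : Solves UniformConsensus t Q)
    (hf : DecidesNoLater t Q (uOpt0 n t)) (h2 : 2 ≤ R.ncard) (hR : n ≤ t + R.ncard)
    (hR' : t + R.ncard ≤ n + 1) (hx : α.Active x (k + 1))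
    (hsub : R ⊆ {q | q ≠ x ∧ α.Edge k q x}) (hact : ∀ p ∈ insert x R, β.Active p k)
    (hsame : ∀ p ∈ insert x R, SameView β α k p) (hs : SeesValue β 0 k x)
    (h : ∀ B ⊆ R, DecidedBy Q (β.survive k x B R) x v (k + 1)) : DecidedBy Q α x v (k + 1) := by
  obtain ⟨z, hz⟩ := (Set.ncard_pos (Set.toFinite R)).1 (by omega)
  have hBR : R \ {z} ⊆ R := Set.sdiff_subset
  have hins : insert x (R \ {z}) ⊆ insert x R := Set.insert_subset_insert hBR
  have hcard : (R \ {z}).ncard + 1 = R.ncard :=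
    Set.ncard_sdiff_singleton_add_one hz (Set.toFinite R)
  have hxR : x ∉ R := fun h => (hsub h).1 rfl
  have hα : ∀ p ∈ insert x R, α.Active p k := by
    rintro p (rfl | hp)
    exacts [hx.mono (Nat.le_succ k), (hsub hp).2.active]
  -- Taking `R'` to be all informers of `x` in `α` gives `x` exactly its view in `α`.
  have key := survive_link (R' := {q | q ≠ x ∧ α.Edge k q x}) ht hQ hf (fun h => hxR h.1)
    ((Set.ncard_pos (Set.toFinite (R \ {z}))).1 (by omega)) (by omega) (by omega)
    (fun p hp => hact p (hins hp)) (fun p hp => hα p (hins hp)) (fun p hp => hsame p (hins hp))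
    hs (h _ hBR)
  refine key.congr ⟨(Adversary.extend_sameView le_rfl).symm, fun q hq => ⟨?_, fun _ =>
    (Adversary.extend_sameView le_rfl).symm⟩⟩ hx
  rw [Adversary.survive_edge_self (hBR.trans hsub) hq]
  exact ⟨fun h => h.2.2, fun e => ⟨e.active, hq, e⟩⟩

/-- In a solution to uniform consensus that never takes its last decision later than `u-Opt₀`,
a process that has seen a `0` decides `0` in the next round if it hears from enough processes. -/
theorem decidedBy_zero_of_informers (ht : t < n) (hQ : Solves UniformConsensus t Q)
    (hf : DecidesNoLater t Q (uOpt0 n t)) (hx : α.Active x (k + 1)) (hs : SeesValue α 0 k x)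
    (hR : max (n - t) 2 ≤ {q | q ≠ x ∧ α.Edge k q x}.ncard) : DecidedBy Q α x 0 (k + 1) := by
  classical
  induction k generalizing α x with
  | zero =>
    -- `R` has exactly `max (n - t) 2` elements, that is `n - t`, or `n - t + 1` if `t = n - 1`. The
    -- second element guarantees that a survivor besides `x` remains when one process of `R` is
    -- removed.
    obtain ⟨R, hRsub, hRc⟩ := Set.exists_subset_card_eq hR
    have h2 : 2 ≤ R.ncard := by omega
    have hR1 : n ≤ t + R.ncard := by omega
    have hR2 : t + R.ncard ≤ n + 1 := by omega
    have hxR : x ∉ R := fun h => (hRsub h).1 rfl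
    have hx0 : α.input x = 0 := by
      obtain ⟨q, hq, h0⟩ := hs
      exact (sees_zero.1 hq).1 ▸ h0
    -- These runs interpolate between all inputs `0` for `W = R`, where validity applies, and for `W
    -- = ∅` a run that agrees with `α` on `x` and `R`.
    let F : Set (Fin n) → Adversary n := fun W =>
      .noCrash fun q => if q ∈ insert x R then (if q ∈ W then 0 else α.input q) else 0
    have hFin : ∀ W q, (F W).input q =
      if q ∈ insert x R then (if q ∈ W then 0 else α.input q) else 0 := fun _ _ => rfl
    have hact : ∀ W ⊆ R, ∀ p ∈ insert x R, (F W).Active p 0 := fun W _ p _ =>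
      (Adversary.noCrash_correct _ p).active 0
    have hsF : SeesValue (F ∅) 0 0 x :=
      ⟨x, sees_self _ 0 x, by rw [hFin, if_pos (Set.mem_insert x R), if_neg (Set.notMem_empty x), hx0]⟩
    refine decidedBy_of_survive ht hQ hf h2 hR1 hR2 hx hRsub (hact ∅ (Set.empty_subset R))
      (fun p hp => ?_) hsF (survive_replace ht hQ hf hxR h2 hR1 hR2 F hact ?_ hsF ?_)
    · change (F ∅).input p = α.input p
      rw [hFin, if_pos hp, if_neg (Set.notMem_empty p)]
    · intro W _ z _ p _ hpz
      change (F W).input p = (F (insert z W)).input p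
      rw [hFin, hFin]
      simp only [Set.mem_insert_iff, hpz, false_or]
    · obtain ⟨z, hz⟩ := (Set.ncard_pos (Set.toFinite R)).1 (by omega)
      have hcard : (R \ {z}).ncard + 1 = R.ncard :=
        Set.ncard_sdiff_singleton_add_one hz (Set.toFinite R)
      have hin0 : ∀ q, (F R).input q = 0 := by
        intro q
        rw [hFin]
        split_ifs with h1 h3
        · rfl
        · rcases h1 with rfl | h1
          exacts [hx0, (h3 h1).elim]
        · rfl
      have hac : ∀ p ∈ insert x (R \ {z}), (F R).Active p 0 := fun p _ =>
        (Adversary.noCrash_correct _ p).active 0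
      have hxB : x ∉ R \ {z} := fun h => hxR h.1
      obtain ⟨u, hu⟩ := survive_decidedBy (R := R) ht hf hxB (by omega) (by omega) hac
        ⟨x, sees_self _ 0 x, hin0 x⟩ (Set.mem_insert x _)
      have hval := (hQ _ (Adversary.survive_inCrash (R := R) hxB (by omega) hac)).2.1 0 hin0 x
        (Adversary.survive_correct.2 ⟨hac x (Set.mem_insert x _), Set.mem_insert x _⟩)
      obtain rfl := decides_unique hu.decides hval
      exact ⟨R \ {z}, Set.sdiff_subset, hu⟩
  | succ k ih =>
    have hx' : α.Active x (k + 1) := hx.mono (Nat.le_succ _)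
    by_cases hprev : SeesValue α 0 k x
    · refine (ih hx' hprev (hR.trans (Set.ncard_le_ncard (fun q hq => ⟨hq.1, ?_⟩)
        (Set.toFinite _)))).mono (Nat.le_succ _)
      exact Adversary.edge_of_active_succ hq.2.active x
    obtain ⟨y, hyx, hye, hys⟩ := hs.exists_edge hprev
    obtain ⟨R, hRsub, hRc⟩ := Set.exists_subset_card_eq hR
    have h2 : 2 ≤ R.ncard := by omega
    have hR1 : n ≤ t + R.ncard := by omega
    have hR2 : t + R.ncard ≤ n + 1 := by omega
    have hxR : x ∉ R := fun h => (hRsub h).1 rfl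
    have hα : ∀ p ∈ insert x R, α.Active p (k + 1) := by
      rintro p (rfl | hp)
      exacts [hx', (hRsub hp).2.active]
    -- `y` showed the first `0` to `x`. If `y ∈ R`, its round had enough informers (`x` and the rest
    -- of `R`), so it has decided `0` by induction, and it can be kept among the survivors.
    by_cases hyR : y ∈ R
    · have hy1 : α.Active y (k + 1) := hα y (Set.mem_insert_of_mem x hyR)
      have hy0 : DecidedBy Q α y 0 (k + 1) := by
        refine ih hy1 hys ?_
        rw [← hRc]
        calc R.ncard = (insert x (R \ {y})).ncard := by
              rw [Set.ncard_insert_of_notMem fun h => hxR h.1,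
                Set.ncard_sdiff_singleton_add_one hyR (Set.toFinite R)]
          _ ≤ _ := Set.ncard_le_ncard (by
              rintro q (rfl | hq)
              · exact ⟨hyx.symm, Adversary.edge_of_active_succ hx' y⟩
              · exact ⟨hq.2, Adversary.edge_of_active_succ
                  (hα q (Set.mem_insert_of_mem x hq.1)) y⟩) (Set.toFinite _)
      refine decidedBy_of_survive ht hQ hf h2 hR1 hR2 hx hRsub hα (fun p _ => SameView.refl α _ p) hs
        fun B' hB' => ?_
      obtain ⟨z, hz, hzy⟩ := Set.exists_ne_of_one_lt_ncard (show 1 < R.ncard by omega) y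
      have hcard : (R \ {z}).ncard + 1 = R.ncard :=
        Set.ncard_sdiff_singleton_add_one hz (Set.toFinite R)
      have hBR : R \ {z} ⊆ R := Set.sdiff_subset
      have hins : insert x (R \ {z}) ⊆ insert x R := Set.insert_subset_insert hBR
      have hxB : x ∉ R \ {z} := fun h => hxR h.1
      have hac : ∀ p ∈ insert x (R \ {z}), α.Active p (k + 1) := fun p hp => hα p (hins hp)
      have hyB : y ∈ insert x (R \ {z}) := Set.mem_insert_of_mem x ⟨hyR, fun e => hzy e.symm⟩
      obtain ⟨u, hu⟩ := survive_decidedBy (R := R) ht hf hxB (by omega) (by omega) hac hs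
        (Set.mem_insert x _)
      have hyc : (α.survive (k + 1) x (R \ {z}) R).Correct y :=
        Adversary.survive_correct.2 ⟨hy1, hyB⟩
      obtain rfl := (hQ _ (Adversary.survive_inCrash (R := R) hxB (by omega) hac)).2.2 x y u 0
        hu.decides (hy0.congr (Adversary.extend_sameView le_rfl) (hyc.active _)).decides
      exact hu.congr (survive_sameView hBR hB') ((Adversary.survive_correct.2
        ⟨hα x (Set.mem_insert x R), Set.mem_insert x B'⟩).active _)
    -- In `F W` the message of `y` also reaches `W`. The run `F ∅` looks like `α` to `x` and `R`,
    -- and `F R` looks to them like `δ`, in which `y` stays alive and decides `0` by induction.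
    · let F : Set (Fin n) → Adversary n := fun W =>
        α.extend k (insert x R)ᶜ fun q => {p | α.Edge k q p ∨ (q = y ∧ p ∈ W)}
      let δ : Adversary n := α.extend k (insert y (insert x R))ᶜ fun q => {p | α.Edge k q p}
      have hFe : ∀ W q p, (F W).Edge k q p ↔
          α.Active q k ∧ (q ∈ (insert x R)ᶜ → α.Edge k q p ∨ (q = y ∧ p ∈ W)) :=
        fun _ _ _ => Adversary.extend_edge_self
      have hδe : ∀ q p, δ.Edge k q p ↔
          α.Active q k ∧ (q ∈ (insert y (insert x R))ᶜ → α.Edge k q p) :=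
        fun _ _ => Adversary.extend_edge_self
      have hFv : ∀ W p, SameView α (F W) k p := fun _ _ => Adversary.extend_sameView le_rfl
      have hδv : ∀ p, SameView α δ k p := fun _ => Adversary.extend_sameView le_rfl
      have hact : ∀ W ⊆ R, ∀ p ∈ insert x R, (F W).Active p (k + 1) := fun W _ p hp =>
        (Adversary.extend_active_of_lt (Nat.lt_succ_self k)).2
          ⟨(hα p hp).mono (Nat.le_succ k), Set.notMem_compl_iff.2 hp⟩
      have hsameF : ∀ p ∈ insert x R, SameView (F ∅) α (k + 1) p := by
        refine fun p hp => ⟨(hFv ∅ p).symm, fun q _ => ⟨?_, fun _ => (hFv ∅ q).symm⟩⟩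
        rw [hFe]
        constructor
        · rintro ⟨-, h⟩
          by_cases hq : q ∈ insert x R
          · exact Adversary.edge_of_active_succ (hα q hq) p
          · exact (h hq).resolve_right fun h => h.2
        · exact fun e => ⟨e.active, fun _ => Or.inl e⟩
      have hsF : SeesValue (F ∅) 0 (k + 1) x := (hsameF x (Set.mem_insert x R)).symm.seesValue hs
      have hδa : ∀ p ∈ insert y (insert x R), δ.Correct p := by
        refine fun p hp => Adversary.extend_correct.2 ⟨?_, Set.notMem_compl_iff.2 hp⟩
        rcases hp with rfl | hp
        exacts [hye.active, (hα p hp).mono (Nat.le_succ k)]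
      have hsameδ : ∀ p ∈ insert x R, SameView δ (F R) (k + 1) p := by
        refine fun p hp => ⟨(hδv p).symm.trans (hFv R p), fun q _ => ⟨?_, fun _ =>
          (hδv q).symm.trans (hFv R q)⟩⟩
        rw [hFe, hδe]
        refine and_congr_right fun _ => ?_
        by_cases hqy : q = y
        · refine iff_of_true (fun h => (h (Or.inl hqy)).elim) fun _ => ?_
          rcases hp with rfl | hp
          exacts [Or.inl (hqy ▸ hye), Or.inr ⟨hqy, hp⟩]
        · simp [hqy]
      have hδx : SeesValue δ 0 (k + 1) x :=
        ((hδv y).seesValue hys).edge ((hδa y (Set.mem_insert y _)).edge k x)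
      have hy0 : DecidedBy Q δ y 0 (k + 1) := by
        refine ih ((hδa y (Set.mem_insert y _)).active _) ((hδv y).seesValue hys) ?_
        rw [← hRc]
        refine Set.ncard_le_ncard (fun q hq => ⟨fun e => hyR (e ▸ hq), ?_⟩) (Set.toFinite _)
        exact (hδa q (Or.inr (Or.inr hq))).edge k y
      refine decidedBy_of_survive ht hQ hf h2 hR1 hR2 hx hRsub (hact ∅ (Set.empty_subset R))
        hsameF hsF (survive_replace ht hQ hf hxR h2 hR1 hR2 F hact ?_ hsF ?_)
      · intro W _ z _ p _ hpz
        refine ⟨(hFv W p).symm.trans (hFv _ p), fun q _ => ⟨?_, fun _ =>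
          (hFv W q).symm.trans (hFv _ q)⟩⟩
        rw [hFe, hFe]
        simp only [Set.mem_insert_iff, hpz, false_or]
      · obtain ⟨z, hz⟩ := (Set.ncard_pos (Set.toFinite R)).1 (by omega)
        have hcard : (R \ {z}).ncard + 1 = R.ncard :=
          Set.ncard_sdiff_singleton_add_one hz (Set.toFinite R)
        have hBR : R \ {z} ⊆ R := Set.sdiff_subset
        have hins : insert x (R \ {z}) ⊆ insert x R := Set.insert_subset_insert hBR
        have hxB : x ∉ R \ {z} := fun h => hxR h.1
        have hac : ∀ p ∈ insert x (R \ {z}), δ.Active p (k + 1) := fun p hp =>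
          (hδa p (Or.inr (hins hp))).active _
        obtain ⟨u, hu⟩ := survive_decidedBy (R := R) ht hf hxB (by omega) (by omega) hac hδx
          (Set.mem_insert x _)
        -- Here `y` does not survive the next round, but it has already decided. Uniform agreement
        -- is essential.
        obtain rfl := (hQ _ (Adversary.survive_inCrash (R := R) hxB (by omega) hac)).2.2 x y u 0
          hu.decides (hy0.congr (Adversary.extend_sameView le_rfl)
            ((Adversary.extend_active_of_le le_rfl).2
              ((hδa y (Set.mem_insert y _)).active _))).decides
        exact ⟨R \ {z}, hBR, survive_link ht hQ hf hxB
          ((Set.ncard_pos (Set.toFinite (R \ {z}))).1 (by omega)) (by omega) (by omega) hac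
          (fun p hp => hact R subset_rfl p (hins hp)) (fun p hp => hsameδ p (hins hp)) hδx hu⟩

end UOptZero

/-! ### Unbeatability of `u-Opt₀` -/

section UOptZeroUnbeatable

variable {n t : ℕ} {Q : Protocol n} {α β : Adversary n} {i j p x : Fin n} {v w : Fin 2}
  {k l m : ℕ}

/-- A process that decides `0` knows that some correct process has seen a `0`. -/
theorem DecidedBy.knows_existsCorrect (ht : t < n) (hQ : Solves UniformConsensus t Q)
    (h : DecidedBy Q α i 0 m) : Knows t (ExistsCorrect t 0) (view α m i) := by
  rw [knows_iff]
  intro β hβ hi hs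
  rw [existsCorrect_iff hβ]
  by_contra hc
  push Not at hc
  -- If all faulty processes fall silent after time `m`, no correct process ever sees a `0`. Yet the
  -- correct ones must decide, and uniform agreement with `i` would make them decide `0`.
  set γ := β.extend m {p | ¬ β.Correct p} fun _ => ∅ with hγdef
  have hcor : ∀ p, β.Correct p → γ.Correct p := fun p hp =>
    Adversary.extend_correct.2 ⟨hp.active m, fun h => h hp⟩
  have hγ : γ.InCrash t := hβ.of_subset hcor
  have hsees : ∀ l p, β.Correct p → ¬ SeesValue γ 0 (m + l) p := by
    intro l
    induction l with
    | zero => exact fun p hp h => hc p hp ((Adversary.extend_sameView le_rfl).symm.seesValue h)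
    | succ l ih =>
      intro p hp h
      obtain ⟨j, -, e, hj⟩ := SeesValue.exists_edge h (ih p hp)
      refine ih j (by_contra fun hjc => ?_) hj
      exact ((Adversary.extend_silent_edge (Nat.le_add_right m l)).1 e).2 hjc
  obtain ⟨p, hp⟩ := Adversary.exists_correct ht hβ
  obtain ⟨u, l, hl⟩ := (hQ γ hγ).1 p (hcor p hp)
  have hu : u = 0 := (hQ γ hγ).2.2 p i u 0 ⟨l, hl⟩
    (h.congr (hs.trans (Adversary.extend_sameView le_rfl))
      ((Adversary.extend_active_of_le le_rfl).2 hi)).decides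
  have hl0 : DecidedBy Q γ p u l := ⟨l, le_rfl, hl⟩
  exact hsees l p hp (hu ▸ (hl0.seesValue (fun β hβ => (hQ β hβ).2.1) hγ hl.1).mono
    (Nat.le_add_left l m))

/-- A process that decides `1` has not seen a `0`, unless it knows that a correct process has. -/
theorem DecidedBy.knows_existsCorrect_of_one (ht : t < n) (hQ : Solves UniformConsensus t Q)
    (hf : DecidesNoLater t Q (uOpt0 n t)) (h : DecidedBy Q α i 1 m) (hs : SeesValue α 0 m i) :
    Knows t (ExistsCorrect t 0) (view α m i) := by
  rw [knows_iff]
  intro β hβ hiβ hsame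
  replace h := h.congr hsame hiβ
  replace hs := hsame.seesValue hs
  by_contra hc
  have hknow : ¬ Knows t (ExistsCorrect t 0) (view β m i) := fun h => hc (h.holds hβ hiβ)
  rw [existsCorrect_iff hβ] at hc
  push Not at hc
  obtain _ | k := m
  · obtain ⟨q, hq, h0⟩ := hs
    obtain ⟨r, hr, h1⟩ := h.seesValue (fun β hβ => (hQ β hβ).2.1) hβ hiβ
    rw [(sees_zero.1 hq).1] at h0
    rw [(sees_zero.1 hr).1, h0] at h1
    exact absurd h1 (by decide)
  obtain ⟨j, hji, e, hj⟩ := hs.exists_edge fun h => hknow (knows_existsCorrect_of_seesValue ht h)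
  have hic : ¬ β.Correct i := fun h => hc i h hs
  have hjc : ¬ β.Correct j := fun h => hc j h (hj.mono (Nat.le_succ k))
  have h1 : i ∉ β.Missing k i := fun h => h.1 rfl
  have h2 : j ∉ insert i (β.Missing k i) := by
    rintro (h | h)
    exacts [hji h, h.2 e]
  have hcard := hβ.ncard_le (S := insert j (insert i (β.Missing k i))) (by
    rintro q (rfl | rfl | hq)
    exacts [hjc, hic, Adversary.Missing.not_correct hq])
  rw [Set.ncard_insert_of_notMem h2, Set.ncard_insert_of_notMem h1] at hcard
  -- Both `i` and its informer `j` are faulty in `β`, so at most `t - 2` processes fail to inform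
  -- `i`. When only those crash, `j` hears from enough others to decide `0`, against the decision of
  -- `i`.
  set γ := β.confirm k i fun _ => ∅ with hγdef
  have hγ : γ.InCrash t := Adversary.confirm_inCrash hβ
  have hiγ : γ.Correct i := Adversary.confirm_correct_self (hiβ.mono (Nat.le_succ k))
  have hcor : ∀ q ∉ β.Missing k i, γ.Correct q := by
    intro q hq
    by_cases hqi : q = i
    · exact hqi ▸ hiγ
    · exact Adversary.confirm_correct (by_contra fun he => hq ⟨hqi, he⟩)
  have hjγ : γ.Correct j := Adversary.confirm_correct e
  have hj0 : DecidedBy Q γ j 0 (k + 1) := by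
    refine decidedBy_zero_of_informers ht hQ hf (hjγ.active _)
      ((Adversary.confirm_sameView le_rfl).seesValue hj) ?_
    have h3 : (insert j (β.Missing k i))ᶜ.ncard ≤ {q | q ≠ j ∧ γ.Edge k q j}.ncard :=
      Set.ncard_le_ncard (fun q hq => ⟨fun e => hq (Or.inl e),
        (hcor q fun h => hq (Or.inr h)).edge k j⟩) (Set.toFinite _)
    rw [ncard_compl_insert fun h => h2 (Or.inr h)] at h3
    omega
  exact absurd ((hQ γ hγ).2.2 j i 0 1 hj0.decides
    (h.congr Adversary.confirm_sameView_succ (hiγ.active _)).decides) (by decide)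

/-- No process decides `1` at time `0` in the presence of a second process. -/
theorem not_decidedBy_one_zero (hQ : Solves UniformConsensus t Q)
    (hf : DecidesNoLater t Q (uOpt0 n t)) (hji : j ≠ i) (hi : α.input i = 1) :
    ¬ DecidedBy Q α i 1 0 := by
  classical
  intro h
  set x : Fin n → Fin 2 := fun q => if q = i then 1 else 0 with hx
  have hxi : x i = 1 := if_pos rfl
  have hxj : ∀ q, q ≠ i → x q = 0 := fun q hq => if_neg hq
  rcases Nat.eq_zero_or_pos t with rfl | ht
  · have hin : ∀ y : Fin n → Fin 2, (Adversary.noCrash y).InCrash 0 := fun y =>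
      Adversary.noCrash_inCrash y
    have hcor : ∀ (β : Adversary n), β.InCrash 0 → ∀ q, β.Correct q := by
      intro β hβ q
      by_contra hq
      have := hβ.ncard_le (S := {q}) (by rintro p rfl; exact hq)
      rw [Set.ncard_singleton] at this
      omega
    have hj : DecidedBy Q (.noCrash fun _ => 0) j 0 0 := by
      obtain ⟨u, hu⟩ := hf _ (hin fun _ => 0) 0 (fun p hp =>
        uOpt0_exists_decidedBy (hin _) hp (Or.inl (knows_iff.2 fun β hβ _ hs =>
          (existsCorrect_iff hβ).2 ⟨p, hcor β hβ p, hs.seesValue ⟨p, sees_self _ 0 p, rfl⟩⟩))) j rfl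
      obtain rfl := decides_unique hu.decides ((hQ _ (hin fun _ => 0)).2.1 0 (fun _ => rfl) j rfl)
      exact hu
    have hj' : DecidedBy Q (.noCrash x) j 0 0 := hj.congr (hxj j hji).symm
      ((Adversary.noCrash_correct x j).active 0)
    have hi' : DecidedBy Q (.noCrash x) i 1 0 := h.congr (hi.trans hxi.symm)
      ((Adversary.noCrash_correct x i).active 0)
    exact absurd ((hQ _ (hin x)).2.2 j i 0 1 hj'.decides hi'.decides) (by decide)
  -- `i` crashes without sending anything, so to the others the run is one with all inputs `0`.
  · set β := (Adversary.noCrash x).extend 0 {i} fun _ => ∅ with hβdef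
    set γ := β.withInput fun _ => 0 with hγdef
    have hcor : ∀ q, q ≠ i → β.Correct q := fun q hq =>
      Adversary.extend_correct.2 ⟨(Adversary.noCrash_correct x q).active 0, hq⟩
    have hβ : β.InCrash t := .of_set {i} (by rw [Set.ncard_singleton]; omega) hcor
    have hγ : γ.InCrash t := hβ
    have hsame : ∀ l q, q ≠ i → SameView γ β l q := by
      intro l
      induction l with
      | zero => exact fun q hq => (hxj q hq).symm
      | succ l ih =>
        refine fun q hq => ⟨ih q hq, fun p _ => ⟨Iff.rfl, fun e => ih p ?_⟩⟩
        exact ((Adversary.extend_silent_edge (Nat.zero_le l)).1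
          (show β.Edge l p q from e)).2
    obtain ⟨l, hl⟩ := (hQ γ hγ).2.1 0 (fun _ => rfl) j (hcor j hji)
    have hj' : DecidedBy Q β j 0 l := DecidedBy.congr ⟨l, le_rfl, hl⟩ (hsame l j hji)
      ((hcor j hji).active l)
    have hi' : DecidedBy Q β i 1 0 := h.congr (hi.trans hxi.symm) bot_le
    exact absurd ((hQ β hβ).2.2 j i 0 1 hj'.decides hi'.decides) (by decide)

/-- A process from which a process `x` that has seen a `0` may be hidden does not decide `1`, if
another process hears from `x`. -/
theorem not_decidedBy_one_of_hidden (ht : t < n) (hQ : Solves UniformConsensus t Q)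
    (hf : DecidesNoLater t Q (uOpt0 n t)) (hβ : β.InCrash t) (hi : β.Active i (k + 1))
    (hx : β.Active x k) (hs : SeesValue β 0 k x) (hxi : x ≠ i) (hxe : ¬ β.Edge k x i)
    (hji : j ≠ i) (hje : β.Edge k j i) : ¬ DecidedBy Q β i 1 (k + 1) := by
  classical
  intro h
  have hik : β.Active i k := hi.mono (Nat.le_succ k)
  set D := β.Missing k i with hD
  have hxD : x ∈ D := ⟨hxi, hxe⟩
  have hiD : i ∉ D := fun h => h.1 rfl
  have hjD : j ∉ D := fun h => h.2 hje
  have hjx : j ≠ x := fun e => hjD (e ▸ hxD)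
  have hDt : D.ncard ≤ t := hβ.ncard_le fun q hq => Adversary.Missing.not_correct hq
  have hact : ∀ q ∉ D, β.Active q k := by
    intro q hq
    by_cases hqi : q = i
    · exact hqi ▸ hik
    · exact Adversary.Edge.active (by_contra fun he => hq ⟨hqi, he⟩ : β.Edge k q i)
  have hD1 : (D \ {x}).ncard + 1 = D.ncard :=
    Set.ncard_sdiff_singleton_add_one hxD (Set.toFinite D)
  -- In `γ` the process `x` stays alive and decides `0`. In `δ` it crashes while reaching everybody
  -- but `i`, which sees the same as in `β`. All processes other than `i` have the same view in both
  -- at time `k + 1`.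
  set γ := β.extend k (D \ {x}) fun _ => ∅ with hγdef
  set δ := β.confirm k i fun q => if q = x then Set.univ else ∅ with hδdef
  have hγx : γ.Correct x := Adversary.extend_correct.2 ⟨hx, fun h => h.2 rfl⟩
  have hγD : ∀ q ∉ D, γ.Correct q := fun q hq =>
    Adversary.extend_correct.2 ⟨hact q hq, fun h => hq h.1⟩
  have hδ : δ.InCrash t := Adversary.confirm_inCrash hβ
  have hδD : ∀ q ∉ D, δ.Correct q := fun q hq => Adversary.extend_correct.2 ⟨hact q hq, hq⟩
  have hδi : SameView β δ (k + 1) i := Adversary.confirm_sameView_succ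
  have hγx0 : DecidedBy Q γ x 0 (k + 1) := by
    refine decidedBy_zero_of_informers ht hQ hf (hγx.active _)
      ((Adversary.extend_sameView le_rfl).seesValue hs) ?_
    have h1 : Dᶜ.ncard ≤ {q | q ≠ x ∧ γ.Edge k q x}.ncard :=
      Set.ncard_le_ncard (fun q hq => ⟨fun e => hq (e ▸ hxD), (hγD q hq).edge k x⟩)
        (Set.toFinite _)
    have h2 : ({i, j} : Set (Fin n)).ncard ≤ Dᶜ.ncard := Set.ncard_le_ncard (by
      rintro q (rfl | rfl)
      exacts [hiD, hjD]) (Set.toFinite _)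
    rw [Set.ncard_pair hji.symm] at h2
    have h3 := Set.ncard_add_ncard_compl D
    rw [Nat.card_eq_fintype_card, Fintype.card_fin] at h3
    omega
  have hsame : ∀ q, q ≠ i → SameView γ δ (k + 1) q := by
    refine fun q hqi => ⟨(Adversary.extend_sameView le_rfl).symm.trans
      (Adversary.extend_sameView le_rfl), fun p _ => ⟨?_, fun _ =>
      (Adversary.extend_sameView le_rfl).symm.trans (Adversary.extend_sameView le_rfl)⟩⟩
    have e1 : γ.Edge k p q ↔ β.Active p k ∧ p ∉ D \ {x} := Adversary.extend_silent_edge le_rfl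
    have e2 : δ.Edge k p q ↔ β.Active p k ∧
        (p ∈ D → q ∈ (if p = x then Set.univ else ∅ : Set (Fin n)) \ {i}) :=
      Adversary.extend_edge_self
    rw [e1, e2]
    refine and_congr_right fun _ => ?_
    by_cases hpx : p = x
    · refine iff_of_true (fun h => h.2 hpx) fun _ => ?_
      rw [if_pos hpx]
      exact ⟨Set.mem_univ q, hqi⟩
    · rw [if_neg hpx]
      exact ⟨fun h1 h2 => (h1 ⟨h2, hpx⟩).elim, fun h1 h2 => (h1 h2.1).1⟩
  -- With `D.ncard = t`, each active process in `γ` misses `t - 1` others and hears from `x`, so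
  -- `u-Opt₀` is finished at `k + 1` and `j` decides `0` by then. With fewer there is one crash to
  -- spare, and `i` is silenced after `k + 1` in both runs (and `x` in `γ`), so that the remaining
  -- processes never tell the runs apart.
  rcases hDt.eq_or_lt with hDt | hDt
  · have hγ : γ.InCrash t := .of_set D hDt.le hγD
    obtain ⟨u, hu⟩ := hf γ hγ (k + 1) (fun p hp => uOpt0_exists_decidedBy hγ hp (Or.inl
      (knows_existsCorrect_of_missing ht ((Adversary.extend_sameView le_rfl).seesValue hs)
        (Or.inr (hγx.edge k p)) (by
          have hpD : p ∉ D \ {x} :=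
            ((Adversary.extend_active_of_lt (Nat.lt_succ_self k)).1 hp).2
          have : (D \ {x}).ncard ≤ (γ.Missing k p).ncard :=
            Set.ncard_le_ncard (fun q hq => ⟨fun e => hpD (e ▸ hq), fun e =>
              ((Adversary.extend_silent_edge le_rfl).1 e).2 hq⟩) (Set.toFinite _)
          omega)))) j (hγD j hjD)
    obtain rfl := (hQ γ hγ).2.2 j x u 0 hu.decides hγx0.decides
    exact absurd ((hQ δ hδ).2.2 j i 0 1
      (hu.congr (hsame j hji) ((hδD j hjD).active _)).decides
      (h.congr hδi ((hδD i hiD).active _)).decides) (by decide)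
  · set γ' := γ.extend (k + 1) {i, x} fun _ => ∅ with hγ'def
    set δ' := δ.extend (k + 1) {i} fun _ => ∅ with hδ'def
    have hcard : (insert i D).ncard ≤ t := by
      rw [Set.ncard_insert_of_notMem hiD]
      omega
    have hγ'c : ∀ q ∉ insert i D, γ'.Correct q := fun q hq => Adversary.extend_correct.2
      ⟨(hγD q fun h => hq (Or.inr h)).active _, by
        rintro (h | h)
        exacts [hq (Or.inl h), hq (Or.inr (h ▸ hxD))]⟩
    have hδ'c : ∀ q ∉ insert i D, δ'.Correct q := fun q hq => Adversary.extend_correct.2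
      ⟨(hδD q fun h => hq (Or.inr h)).active _, fun h => hq (Or.inl h)⟩
    have hγ' : γ'.InCrash t := .of_set _ hcard hγ'c
    have hδ' : δ'.InCrash t := .of_set _ hcard hδ'c
    have hsame' : ∀ l q, q ∉ insert i D → SameView γ' δ' (k + 1 + l) q := by
      intro l
      induction l with
      | zero =>
        exact fun q hq => (Adversary.extend_sameView le_rfl).symm.trans
          ((hsame q fun e => hq (Or.inl e)).trans (Adversary.extend_sameView le_rfl))
      | succ l ih =>
        refine fun q hq => ⟨ih q hq, fun p _ => ?_⟩
        have e1 : γ'.Edge (k + 1 + l) p q ↔ p ∉ insert i D := by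
          refine ⟨fun e => ?_, fun hp => (hγ'c p hp).edge _ q⟩
          obtain ⟨h1, h2⟩ := (Adversary.extend_silent_edge (Nat.le_add_right _ l)).1 e
          obtain ⟨-, h3⟩ := (Adversary.extend_active_of_lt (Nat.lt_succ_self k)).1 h1
          rintro (hp | hp)
          · exact h2 (Or.inl hp)
          · exact h3 ⟨hp, fun h => h2 (Or.inr h)⟩
        have e2 : δ'.Edge (k + 1 + l) p q ↔ p ∉ insert i D := by
          refine ⟨fun e => ?_, fun hp => (hδ'c p hp).edge _ q⟩
          obtain ⟨h1, h2⟩ := (Adversary.extend_silent_edge (Nat.le_add_right _ l)).1 e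
          obtain ⟨-, h3⟩ := (Adversary.extend_active_of_lt (Nat.lt_succ_self k)).1 h1
          rintro (hp | hp)
          exacts [h2 hp, h3 hp]
        exact ⟨e1.trans e2.symm, fun e => ih p (e1.1 e)⟩
    have hjI : j ∉ insert i D := by
      rintro (h | h)
      exacts [hji h, hjD h]
    obtain ⟨u, l, hl⟩ := (hQ γ' hγ').1 j (hγ'c j hjI)
    have hx0 : DecidedBy Q γ' x 0 (k + 1) := hγx0.congr (Adversary.extend_sameView le_rfl)
      ((Adversary.extend_active_of_le le_rfl).2 (hγx.active _))
    obtain rfl := (hQ γ' hγ').2.2 j x u 0 ⟨l, hl⟩ hx0.decides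
    have hj0 : DecidedBy Q δ' j 0 (k + 1 + l) :=
      DecidedBy.congr ⟨l, Nat.le_add_left l _, hl⟩ (hsame' l j hjI) ((hδ'c j hjI).active _)
    have hi1 : DecidedBy Q δ' i 1 (k + 1) :=
      h.congr (hδi.trans (Adversary.extend_sameView le_rfl))
        ((Adversary.extend_active_of_le le_rfl).2 ((hδD i hiD).active _))
    exact absurd ((hQ δ' hδ').2.2 j i 0 1 hj0.decides hi1.decides) (by decide)

/-- If `i` decides `1` having seen no `0` and with no time revealed, a hidden chain may start at an
input `0`. Its node at time `k` plays the role of `x`, and its correct endpoint that of the other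
informer, in `not_decidedBy_one_of_hidden`. -/
theorem uOpt0_decided (ht : t < n) (hQ : Solves UniformConsensus t Q)
    (hf : DecidesNoLater t Q (uOpt0 n t)) (hα : α.InCrash t) (hi : α.Active i m)
    (h : DecidedBy Q α i v m) : ∃ w, DecidedBy (uOpt0 n t) α i w m := by
  classical
  refine uOpt0_exists_decidedBy hα hi ?_
  match v, h with
  | 0, h => exact Or.inl (h.knows_existsCorrect ht hQ)
  | 1, h =>
    by_cases hs : SeesValue α 0 m i
    · exact Or.inl (h.knows_existsCorrect_of_one ht hQ hf hs)
    refine Or.inr ⟨hs, by_contra fun hrev => ?_⟩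
    obtain _ | k := m
    · rw [someTimeRevealed_iff] at hrev
      push Not at hrev
      obtain ⟨j, hj⟩ := hrev 0 le_rfl
      have hji : j ≠ i := by
        rintro rfl
        exact hj (nodeRevealed_iff.2 (Or.inl (sees_self α 0 j)))
      have hi1 : α.input i = 1 := by
        have : α.input i ≠ 0 := fun e => hs ⟨i, sees_self α 0 i, e⟩
        omega
      exact not_decidedBy_one_zero hQ hf hji hi1 h
    · let x : Fin n → Fin 2 := fun q => if Sees α 0 q (k + 1) i then α.input q else 0
      obtain ⟨β, c, hin, hβ, hiβ, hsame, hc0, hcm, hci, hc, -⟩ := exists_hidden_chain hα hi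
        (Nat.le_add_left 1 k) hrev x fun q hq => (if_pos hq).symm
      have hchain : ∀ l ≤ k, SeesValue β 0 l (c l) := by
        intro l
        induction l with
        | zero => exact fun _ => ⟨c 0, sees_self β 0 _, (congrFun hin (c 0)).trans (if_neg hc0)⟩
        | succ l ih => exact fun hl => (ih (by omega)).edge (hc l (by omega)).2.1
      have hk := hc k (Nat.lt_succ_self k)
      exact not_decidedBy_one_of_hidden ht hQ hf hβ hiβ hk.2.1.active (hchain k le_rfl)
        (hci k (Nat.le_succ k)) hk.2.2 (hci (k + 1) le_rfl) (hcm.edge k i) (h.congr hsame hiβ)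

theorem uOpt0_ldUnbeatable {who : Adversary n → Fin n → Prop} (ht : t < n)
    (hwho : ∀ α i, α.Correct i → who α i) : LDUnbeatable who UniformConsensus t (uOpt0 n t) :=
  ldUnbeatable_of ht hwho (fun _ _ h => h.1) (uOpt0_solves ht)
    (fun _ hQ hf _ hα _ _ m hi h => uOpt0_decided ht hQ hf hα (hi.active m) h)
    fun _ hα _ _ _ hp h _ hi => uOpt0_spread hα hp h hi

end UOptZeroUnbeatable

theorem mainTheorem5 (n t : ℕ) (hn : 2 ≤ n) (ht : t < n) :
    (LDUnbeatable everyone Consensus t (opt0 n t) ∧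
      (0 < t → LDUnbeatable everyone Consensus t (optMaj n t)) ∧
      LDUnbeatable everyone UniformConsensus t (uOpt0 n t)) ∧
    (LDUnbeatable Adversary.Correct Consensus t (opt0 n t) ∧
      (0 < t → LDUnbeatable Adversary.Correct Consensus t (optMaj n t)) ∧
      LDUnbeatable Adversary.Correct UniformConsensus t (uOpt0 n t)) := by
  have all : ∀ (α : Adversary n) i, α.Correct i → everyone α i := fun _ _ _ => trivial
  have cor : ∀ (α : Adversary n) i, α.Correct i → α.Correct i := fun _ _ h => h
  exact ⟨⟨opt0_ldUnbeatable ht all, fun h => optMaj_ldUnbeatable ht h all,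
    uOpt0_ldUnbeatable ht all⟩, opt0_ldUnbeatable ht cor, fun h => optMaj_ldUnbeatable ht h cor,
    uOpt0_ldUnbeatable ht cor⟩
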